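/- Let $K$ be an infinite field of characteristic different from $2$ (characteristic $0$ allowed), let $q$ be a prime, and assume that $K$ contains a primitive $q$-th root of unity $\varepsilon$. Let $G=\mathbb{Z}_q\times\mathbb{Z}_q$ and let $L=sl_q(K)$ carry the Pauli $G$-grading: $L_{(0,0)}=0$ and $L_{(i,j)}=K\,A^iB^j$ for $(i,j)\ne(0,0)$, where $A=\mathrm{diag}(\varepsilon^{q-1},\varepsilon^{q-2},\dots,1)$ and $B=E_{12}+E_{23}+\dots+E_{q-1,q}+E_{q1}$. Let $L\langle X_G\rangle$ be the free Lie algebra over $K$ on the variables $x_i^g$ ($g\in G$, $i\in\mathbb{N}$), graded by giving $x_i^g$ degree $g$. Let $T_G(L)$ be the set of graded identities of $L$, that is, of all $f\in L\langle X_G\rangle$ that vanish whenever each variable $x_i^g$ is replaced by an arbitrary element of $L_g$. A $T_G$-ideal is an ideal of $L\langle X_G\rangle$ invariant under all its endomorphisms as a graded Lie algebra. Commutators are left-normed: $[a,b,c]=[[a,b],c]$, and so on. For $g\in G$ put $C(g)=\{h\in G : [L_g,L_h]=0\}$, and put $\mathrm{supp}\,L=\{g\in G: L_g\neq 0\}$.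 Then: (a) For all $g,h,k\in G$ with $[x_1^g,x_2^h,x_3^k]\notin T_G(L)$ there is a unique $\lambda_{g,h,k}\in K$ such that $[x_1^g,x_3^k,x_2^h]-\lambda_{g,h,k}[x_1^g,x_2^h,x_3^k]\in T_G(L)$. (b) For all $\mathbf g=(g_1,g_2,g_3,g_4)\in G^4$ such that, with $x_i=x_i^{g_i}$, neither $[x_4,x_1,x_2,x_3]$ nor $[x_4,x_3,x_2,x_1]$ lies in $T_G(L)$, there is a unique $\lambda_{\mathbf g}\in K$ such that $[x_4,x_1,x_2,x_3]-\lambda_{\mathbf g}[x_4,x_3,x_2,x_1]\in T_G(L)$, and $\lambda_{\mathbf g}\neq0$. (c) The following polynomials form a basis of the graded identities of $L$, that is, the smallest $T_G$-ideal of $L\langle X_G\rangle$ containing them is equal to $T_G(L)$: 1. $x_1^g$, for $g\notin\mathrm{supp}\,L$; 2. $[x_1^g,x_2^h]$, for $g\in G$ and $h\in C(g)$ with $g+h\in\mathrm{supp}\,L$; 3. $[x_1^g,x_3^k,x_2^h]-\lambda_{g,h,k}[x_1^g,x_2^h,x_3^k]$, for all $g,h,k\in G$ as in (a); 4. $[x_4,x_1,x_2,x_3]-\lambda_{\mathbf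 g}[x_4,x_3,x_2,x_1]$ with $x_i=x_i^{g_i}$, for all $\mathbf g\in G^4$ as in (b). -/

import Mathlib

/-! ## Graded identities of graded Lie algebras -/

noncomputable section GradedIdentities

universe u v w

variable (K : Type u) [Field K] (G : Type v) [AddCommGroup G]

/-- The free `G`-graded Lie algebra `L⟨X_G⟩`: the free Lie algebra on the variables `x_i^g`,
where `(g, i)` stands for `x_i^g`. -/
abbrev FreeGradedLie : Type _ := FreeLieAlgebra K (G × ℕ)

variable {G}

/-- The variable `x_i^g`. -/
def gvar (i : ℕ) (g : G) : FreeGradedLie K G := FreeLieAlgebra.of K (g, i)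

variable {K}

/-- `IsGradedMonomial f g`: the element `f` is a (nonassociative Lie) monomial in the variables
and the degrees of its variables add up to `g`. -/
inductive IsGradedMonomial : FreeGradedLie K G → G → Prop
  | var (i : ℕ) (g : G) : IsGradedMonomial (gvar K i g) g
  | bracket {a b : FreeGradedLie K G} {g h : G} :
      IsGradedMonomial a g → IsGradedMonomial b h → IsGradedMonomial ⁅a, b⁆ (g + h)

variable (K)

/-- The homogeneous component of degree `g` of `L⟨X_G⟩`. -/
def freeComponent (g : G) : Submodule K (FreeGradedLie K G) :=
  Submodule.span K {f | IsGradedMonomial f g}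

variable {K}

/-- An endomorphism of `L⟨X_G⟩` as a graded algebra. -/
def IsGradedEnd (φ : FreeGradedLie K G →ₗ⁅K⁆ FreeGradedLie K G) : Prop :=
  ∀ g : G, ∀ f ∈ freeComponent K g, φ f ∈ freeComponent K g

/-- A `T_G`-ideal: an ideal of `L⟨X_G⟩` invariant under all graded endomorphisms. -/
def IsTIdeal (I : LieIdeal K (FreeGradedLie K G)) : Prop :=
  ∀ φ : FreeGradedLie K G →ₗ⁅K⁆ FreeGradedLie K G, IsGradedEnd φ → ∀ f ∈ I, φ f ∈ I

/-- The `T_G`-ideal `⟨S⟩_G` generated by `S`: the intersection of all `T_G`-ideals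
containing `S`. -/
def tIdealSpan (S : Set (FreeGradedLie K G)) : LieIdeal K (FreeGradedLie K G) :=
  sInf {I | IsTIdeal I ∧ S ⊆ (I : Set (FreeGradedLie K G))}

variable {L : Type w} [LieRing L] [LieAlgebra K L]

/-- The set `T_G(L)` of graded identities of `L`, where `Γ g` is the homogeneous component of
degree `g` of `L`: those `f` that vanish under all admissible substitutions. -/
def gradedIdentities (Γ : G → Submodule K L) : Set (FreeGradedLie K G) :=
  {f | ∀ a : G × ℕ → L, (∀ g i, a (g, i) ∈ Γ g) → FreeLieAlgebra.lift K a f = 0}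

/-- The support of the grading. -/
def gradingSupport (Γ : G → Submodule K L) : Set G := {g | Γ g ≠ ⊥}

/-- `C(g)`: those `h` with `[L_g, L_h] = 0`. -/
def gradingCentralizer (Γ : G → Submodule K L) (g : G) : Set G :=
  {h | ∀ a ∈ Γ g, ∀ b ∈ Γ h, ⁅a, b⁆ = 0}

variable (K)

/-- The left-normed commutator `[x_i^g, x_j^h, x_k^l]`. -/
def comm3 (i : ℕ) (g : G) (j : ℕ) (h : G) (k : ℕ) (l : G) : FreeGradedLie K G :=
  ⁅⁅gvar K i g, gvar K j h⁆, gvar K k l⁆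

/-- The left-normed commutator `[x_i^g, x_j^h, x_k^l, x_m^r]`. -/
def comm4 (i : ℕ) (g : G) (j : ℕ) (h : G) (k : ℕ) (l : G) (m : ℕ) (r : G) : FreeGradedLie K G :=
  ⁅⁅⁅gvar K i g, gvar K j h⁆, gvar K k l⁆, gvar K m r⁆

variable {K}

/-- The polynomial `[x_1^g, x_3^k, x_2^h] - c [x_1^g, x_2^h, x_3^k]`. -/
def cubicPoly (c : K) (g h k : G) : FreeGradedLie K G :=
  comm3 K 1 g 3 k 2 h - c • comm3 K 1 g 2 h 3 k

/-- The polynomial `[x_4, x_1, x_2, x_3] - c [x_4, x_3, x_2, x_1]` where `x_i` has degree `g_i`. -/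
def quarticPoly (c : K) (g₁ g₂ g₃ g₄ : G) : FreeGradedLie K G :=
  comm4 K 4 g₄ 1 g₁ 2 g₂ 3 g₃ - c • comm4 K 4 g₄ 3 g₃ 2 g₂ 1 g₁

/-- The variables `x_1^g` with `g` outside the support. -/
def basisOne (Γ : G → Submodule K L) : Set (FreeGradedLie K G) :=
  {f | ∃ g : G, g ∉ gradingSupport Γ ∧ f = gvar K 1 g}

/-- The commutators `[x_1^g, x_2^h]` with `h ∈ C(g)` and `g + h` in the support. -/
def basisTwo (Γ : G → Submodule K L) : Set (FreeGradedLie K G) :=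
  {f | ∃ g h : G, h ∈ gradingCentralizer Γ g ∧ g + h ∈ gradingSupport Γ ∧
    f = ⁅gvar K 1 g, gvar K 2 h⁆}

/-- The condition that `[x_1^g, x_2^h, x_3^k]` is not a graded identity of `L`. -/
def CubicAdmissible (Γ : G → Submodule K L) (g h k : G) : Prop :=
  comm3 K 1 g 2 h 3 k ∉ gradedIdentities Γ

/-- The condition that neither `[x_4, x_1, x_2, x_3]` nor `[x_4, x_3, x_2, x_1]` is a graded
identity of `L`, where `x_i` has degree `g_i`. -/
def QuarticAdmissible (Γ : G → Submodule K L) (g₁ g₂ g₃ g₄ : G) : Prop :=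
  comm4 K 4 g₄ 1 g₁ 2 g₂ 3 g₃ ∉ gradedIdentities Γ ∧
    comm4 K 4 g₄ 3 g₃ 2 g₂ 1 g₁ ∉ gradedIdentities Γ

/-- The polynomials `[x_1^g, x_3^k, x_2^h] - λ_{g,h,k} [x_1^g, x_2^h, x_3^k]`, one for each
triple such that `[x_1^g, x_2^h, x_3^k]` is not a graded identity. -/
def basisThree (Γ : G → Submodule K L) (lam : G → G → G → K) : Set (FreeGradedLie K G) :=
  {f | ∃ g h k : G, CubicAdmissible Γ g h k ∧ f = cubicPoly (lam g h k) g h k}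

/-- The polynomials `[x_4, x_1, x_2, x_3] - λ [x_4, x_3, x_2, x_1]`, one for each choice of the
degrees of the variables such that neither monomial is a graded identity. -/
def basisFour (Γ : G → Submodule K L) (lam : G → G → G → G → K) : Set (FreeGradedLie K G) :=
  {f | ∃ g₁ g₂ g₃ g₄ : G, QuarticAdmissible Γ g₁ g₂ g₃ g₄ ∧
    f = quarticPoly (lam g₁ g₂ g₃ g₄) g₁ g₂ g₃ g₄}

end GradedIdentities

/-! ## The Pauli grading on `sl_m(K)` -/

noncomputable section Pauli

universe u

variable {K : Type u} [Field K]

/-- The diagonal matrix `A = diag(ε^{m-1}, ε^{m-2}, …, 1)`. -/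
def pauliA (m : ℕ) (ε : K) : Matrix (Fin m) (Fin m) K :=
  Matrix.diagonal fun i => ε ^ (m - 1 - (i : ℕ))

/-- The cyclic permutation matrix `B`, with ones at the positions `(i, i + 1)` (indices
modulo `m`). -/
def pauliB (m : ℕ) : Matrix (Fin m) (Fin m) K :=
  Matrix.of fun i j => if (j : ℕ) = ((i : ℕ) + 1) % m then 1 else 0

/-- The homogeneous components of the Pauli grading on `sl_m(K)` by `ℤ_m × ℤ_m`: the component
of degree `(0, 0)` is zero and that of degree `(i, j) ≠ (0, 0)` is `K (A^i B^j)`. -/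
def pauliComponent (m : ℕ) (ε : K) (g : ZMod m × ZMod m) :
    Submodule K (LieAlgebra.SpecialLinear.sl (Fin m) K) :=
  if g = 0 then ⊥
  else (Submodule.span K {pauliA m ε ^ g.1.val * pauliB m ^ g.2.val}).comap
    (LieAlgebra.SpecialLinear.sl (Fin m) K).subtype

end Pauli

/-!
Let `u_g` denote the basis vector `A^i B^j` of degree `g = (i, j)`. Evaluating each variable
`x_i^g` at `t_{g,i} u_g` turns a Lie monomial into a product of structure constants, times a
commutative monomial in the scalars `t_{g,i}`, times the vector `u` of the total degree. Over an
infinite field distinct commutative monomials are linearly independent, so it suffices to show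
that modulo the four families of identities any two nonvanishing Lie monomials in the same
variables, with multiplicities, are proportional.

Dividing the bracket of homogeneous elements by its structure constant gives a partial commutative
product, defined on `x` and `y` when the symplectic form of their degrees is nonzero. The identities
of degrees three and four become the exchange laws `(x y) z = (x z) y` and
`((w x) y) z = ((w z) y) x`. By induction on the number of factors, the product of a multiset then
does not depend on the order of multiplications: it remains to connect any two choices of the first
pair to be multiplied. Disjoint pairs can be multiplied one after the other, and pairs with a common
factor are related by the cubic law or through a chain of other pairs; only for four factors is the
quartic law needed as well. Throughout, a factor whose degree is not proportional to the total
degree ensures that the remaining multiplications can be carried out without meeting a zero product.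
-/

section SympForm

variable {k : Type*} [CommRing k]

/-- The standard symplectic form on the plane `k × k`. For the Pauli grading it decides which
homogeneous elements commute. -/
def sympForm (x y : k × k) : k := x.1 * y.2 - x.2 * y.1

theorem sympForm_self (x : k × k) : sympForm x x = 0 := by
  simp only [sympForm]; ring

theorem sympForm_swap (x y : k × k) : sympForm y x = -sympForm x y := by
  simp only [sympForm]; ring

theorem sympForm_add_left (x y z : k × k) :
    sympForm (x + y) z = sympForm x z + sympForm y z := by
  simp only [sympForm, Prod.fst_add, Prod.snd_add]; ring

theorem sympForm_add_right (x y z : k × k) :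
    sympForm x (y + z) = sympForm x y + sympForm x z := by
  simp only [sympForm, Prod.fst_add, Prod.snd_add]; ring

theorem sympForm_zero_left (x : k × k) : sympForm 0 x = 0 := by simp [sympForm]

theorem sympForm_zero_right (x : k × k) : sympForm x 0 = 0 := by simp [sympForm]

theorem sympForm_pluecker (x y z w : k × k) :
    sympForm x y * sympForm z w - sympForm x z * sympForm y w + sympForm x w * sympForm y z =
      0 := by
  simp only [sympForm]; ring

theorem sympForm_ne_zero_comm {x y : k × k} : sympForm x y ≠ 0 ↔ sympForm y x ≠ 0 := by
  rw [sympForm_swap y x, neg_ne_zero]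

theorem ne_zero_left_of_sympForm {x y : k × k} (h : sympForm x y ≠ 0) : x ≠ 0 := by
  rintro rfl
  exact h (sympForm_zero_left y)

theorem ne_zero_right_of_sympForm {x y : k × k} (h : sympForm x y ≠ 0) : y ≠ 0 :=
  ne_zero_left_of_sympForm (sympForm_ne_zero_comm.mp h)

theorem add_ne_zero_of_sympForm {x y : k × k} (h : sympForm x y ≠ 0) : x + y ≠ 0 := by
  refine ne_zero_left_of_sympForm (y := y) ?_
  rwa [sympForm_add_left, sympForm_self, add_zero]

theorem exists_sympForm_ne_zero {x : k × k} (hx : x ≠ 0) : ∃ y, sympForm x y ≠ 0 := by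
  by_contra! hall
  have h₁ : x.1 = 0 := by simpa [sympForm] using hall (0, 1)
  have h₂ : x.2 = 0 := by simpa [sympForm] using hall (1, 0)
  exact hx (Prod.ext h₁ h₂)

theorem sympForm_eq_zero_trans [NoZeroDivisors k] {x y z : k × k} (hy : y ≠ 0)
    (hxy : sympForm x y = 0) (hyz : sympForm y z = 0) : sympForm x z = 0 := by
  simp only [sympForm] at *
  rcases ne_or_eq y.1 0 with hy₁ | hy₁
  · apply mul_left_cancel₀ hy₁
    linear_combination z.1 * hxy + x.1 * hyz
  · have hy₂ : y.2 ≠ 0 := fun hy₂ => hy (Prod.ext hy₁ hy₂)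
    apply mul_left_cancel₀ hy₂
    linear_combination z.2 * hxy + x.2 * hyz

theorem sympForm_ne_zero_of_parallel [NoZeroDivisors k] {x y z : k × k} (hy : y ≠ 0)
    (hxy : sympForm x y = 0) (hxz : sympForm x z ≠ 0) : sympForm y z ≠ 0 :=
  fun hyz => hxz (sympForm_eq_zero_trans hy hxy hyz)

theorem sympForm_ne_zero_of_add_parallel [NoZeroDivisors k] {x y z w : k × k}
    (hxy : sympForm x y ≠ 0) (hxz : sympForm x z ≠ 0) (hxyz : sympForm (x + y) z = 0)
    (hw : sympForm (x + y + z) w ≠ 0) :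
    sympForm z w ≠ 0 ∧ sympForm (x + y) w ≠ 0 ∧ sympForm x (y + z) ≠ 0 := by
  have hsum : sympForm (x + y + z) z = 0 := by
    rw [sympForm_add_left, hxyz, sympForm_self, add_zero]
  refine ⟨sympForm_ne_zero_of_parallel (ne_zero_right_of_sympForm hxz) hsum hw,
    sympForm_ne_zero_of_parallel (add_ne_zero_of_sympForm hxy) ?_ hw, fun hx => hxz ?_⟩
  · rw [sympForm_add_left, sympForm_self, sympForm_swap, hxyz, neg_zero, add_zero]
  · refine sympForm_eq_zero_trans (ne_zero_left_of_sympForm hw) ?_ hsum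
    rw [add_assoc, sympForm_add_right, sympForm_self, hx, add_zero]

theorem sympForm_eq_zero_of_forall_mem {H : Type*} {deg : H → k × k} {x : k × k} {S : Multiset H}
    (h : ∀ a ∈ S, sympForm x (deg a) = 0) : sympForm x (S.map deg).sum = 0 := by
  induction S using Multiset.induction with
  | empty => exact sympForm_zero_right x
  | cons a S ih =>
    rw [Multiset.map_cons, Multiset.sum_cons, sympForm_add_right, h a (Multiset.mem_cons_self a S),
      ih fun b hb => h b (Multiset.mem_cons_of_mem hb), add_zero]

end SympForm

section Merging

variable {k : Type*} [CommRing k] {H : Type*} {deg : H → k × k} {S R : Multiset H}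
  {a b u v x y : H}

/-- The element `x` is *transverse* to `S`: its degree pairs nontrivially with the total degree of
`S`. Over a field this means that the two degrees are linearly independent. -/
def Transverse (deg : H → k × k) (S : Multiset H) (x : H) : Prop :=
  sympForm (S.map deg).sum (deg x) ≠ 0

theorem Transverse.exists_of_cons (hx : Transverse deg (x ::ₘ R) x) :
    ∃ y ∈ R, Transverse deg (x ::ₘ R) y := by
  by_contra! hR
  apply hx
  have hsum := sympForm_add_right ((x ::ₘ R).map deg).sum (deg x) (R.map deg).sum
  rw [← Multiset.sum_cons, ← Multiset.map_cons, sympForm_self,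
    sympForm_eq_zero_of_forall_mem fun y hy => not_not.mp (hR y hy), add_zero] at hsum
  exact hsum.symm

theorem Transverse.exists_sympForm_ne_zero (hx : Transverse deg (x ::ₘ R) x) :
    ∃ y ∈ R, sympForm (deg x) (deg y) ≠ 0 := by
  by_contra! hR
  apply hx
  rw [sympForm_swap, Multiset.map_cons, Multiset.sum_cons, sympForm_add_right, sympForm_self,
    sympForm_eq_zero_of_forall_mem hR, add_zero, neg_zero]

theorem Transverse.or_of_sympForm_ne_zero [NoZeroDivisors k] (hx : Transverse deg S x)
    (hab : sympForm (deg a) (deg b) ≠ 0) : Transverse deg S a ∨ Transverse deg S b := by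
  by_contra! hn
  simp only [Transverse, not_not] at hn
  refine hab (sympForm_eq_zero_trans (ne_zero_left_of_sympForm hx) ?_ hn.2)
  rw [sympForm_swap, hn.1, neg_zero]

/-- The condition on the degrees of the elements of `S` which guarantees that `S` has a merge
result; for at least two elements it is also necessary. -/
def Mergeable (deg : H → k × k) (S : Multiset H) : Prop :=
  (∀ a ∈ S, deg a ≠ 0) ∧ (S.card = 1 ∨ ∃ a ∈ S, Transverse deg S a)

theorem mergeable_pair (hab : sympForm (deg a) (deg b) ≠ 0) :
    Mergeable deg (a ::ₘ b ::ₘ 0) := by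
  refine ⟨?_, .inr ⟨b, by simp, ?_⟩⟩
  · simp [ne_zero_left_of_sympForm hab, ne_zero_right_of_sympForm hab]
  · simpa [Transverse, sympForm_add_left, sympForm_self] using hab

theorem Mergeable.exists_sympForm_ne_zero [NoZeroDivisors k] (h : Mergeable deg S)
    (hS : 2 ≤ S.card) :
    ∃ a b R, S = a ::ₘ b ::ₘ R ∧ sympForm (deg a) (deg b) ≠ 0 ∧
      (R = 0 ∨ ∃ x ∈ R, Transverse deg S x) := by
  obtain ⟨h₀, hcard | ⟨a, ha, haS⟩⟩ := h
  · omega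
  obtain ⟨T, rfl⟩ := Multiset.exists_cons_of_mem ha
  obtain ⟨b, hb, hbS⟩ := haS.exists_of_cons
  obtain ⟨x, hx, hax⟩ := haS.exists_sympForm_ne_zero
  obtain ⟨T, rfl⟩ := Multiset.exists_cons_of_mem hb
  rcases Multiset.mem_cons.mp hx with rfl | hx
  · rcases T.empty_or_exists_mem with rfl | ⟨c, hc⟩
    · exact ⟨a, x, 0, rfl, hax, .inl rfl⟩
    obtain ⟨W, rfl⟩ := Multiset.exists_cons_of_mem hc
    rcases ne_or_eq (sympForm (deg a) (deg c)) 0 with hac | hac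
    · exact ⟨a, c, x ::ₘ W, by simp only [Multiset.cons_swap], hac, .inr ⟨x, by simp, hbS⟩⟩
    · refine ⟨c, x, a ::ₘ W, by simp only [Multiset.cons_swap], fun hcx => hax ?_,
        .inr ⟨a, by simp, haS⟩⟩
      exact sympForm_eq_zero_trans (h₀ c (by simp)) hac hcx
  · obtain ⟨W, rfl⟩ := Multiset.exists_cons_of_mem hx
    exact ⟨a, x, b ::ₘ W, by simp only [Multiset.cons_swap], hax, .inr ⟨b, by simp, hbS⟩⟩

variable [Mul H]

/-- A commutative multiplication, graded by the plane, which satisfies two exchange laws as far as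
all products involved are products of elements whose degrees pair nontrivially. -/
structure IsSympMagma (deg : H → k × k) : Prop where
  mul_comm : ∀ x y : H, x * y = y * x
  deg_mul : ∀ x y : H, deg (x * y) = deg x + deg y
  cubic : ∀ x y z : H, sympForm (deg x) (deg y) ≠ 0 → sympForm (deg x + deg y) (deg z) ≠ 0 →
    sympForm (deg x) (deg z) ≠ 0 → sympForm (deg x + deg z) (deg y) ≠ 0 →
    x * y * z = x * z * y
  quartic : ∀ w x y z : H, sympForm (deg w) (deg x) ≠ 0 → sympForm (deg w + deg x) (deg y) ≠ 0 →
    sympForm (deg w + deg x + deg y) (deg z) ≠ 0 → sympForm (deg w) (deg z) ≠ 0 →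
    sympForm (deg w + deg z) (deg y) ≠ 0 → sympForm (deg w + deg z + deg y) (deg x) ≠ 0 →
    w * x * y * z = w * z * y * x

/-- `MergesTo deg S v`: one can multiply the elements of `S` together, in some order and with
some bracketing, so that the result is `v` and only elements whose degrees pair nontrivially are
ever multiplied. -/
inductive MergesTo (deg : H → k × k) : Multiset H → H → Prop
  | single (a : H) : MergesTo deg {a} a
  | merge {a b : H} {R : Multiset H} {v : H} : sympForm (deg a) (deg b) ≠ 0 →
      MergesTo deg ((a * b) ::ₘ R) v → MergesTo deg (a ::ₘ b ::ₘ R) v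

/-- The set of all results of merging `S`. -/
def mergeResults (deg : H → k × k) (S : Multiset H) : Set H := {v | MergesTo deg S v}

theorem MergesTo.of_add (hS : MergesTo deg S u) (hR : MergesTo deg (u ::ₘ R) v) :
    MergesTo deg (S + R) v := by
  induction hS with
  | single a => rwa [Multiset.singleton_add]
  | merge hab _ ih =>
    rw [Multiset.cons_add, Multiset.cons_add]
    exact .merge hab (by simpa only [Multiset.cons_add] using ih hR)

theorem MergesTo.mul (hS : MergesTo deg S u) (hR : MergesTo deg R v)
    (huv : sympForm (deg u) (deg v) ≠ 0) : MergesTo deg (S + R) (u * v) := by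
  have hSv : MergesTo deg (S + {v}) (u * v) := hS.of_add (.merge huv (.single _))
  rw [add_comm, Multiset.singleton_add] at hSv
  exact add_comm R S ▸ hR.of_add hSv

theorem MergesTo.deg_eq (hd : IsSympMagma deg) (h : MergesTo deg S v) :
    deg v = (S.map deg).sum := by
  induction h with
  | single a => simp only [Multiset.map_singleton, Multiset.sum_singleton]
  | merge _ _ ih =>
    rw [ih]
    simp only [Multiset.map_cons, Multiset.sum_cons, hd.deg_mul, add_assoc]

theorem transverse_mul_cons_iff (hd : IsSympMagma deg) :
    Transverse deg ((a * b) ::ₘ R) x ↔ Transverse deg (a ::ₘ b ::ₘ R) x := by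
  simp only [Transverse, Multiset.map_cons, Multiset.sum_cons, hd.deg_mul, add_assoc]

theorem Mergeable.of_mul_cons (hd : IsSympMagma deg) (hab : sympForm (deg a) (deg b) ≠ 0)
    (h : Mergeable deg ((a * b) ::ₘ R)) : Mergeable deg (a ::ₘ b ::ₘ R) := by
  obtain ⟨h₀, hR | ⟨x, hx, hxR⟩⟩ := h
  · obtain rfl : R = 0 := by simpa using hR
    exact mergeable_pair hab
  rw [Multiset.forall_mem_cons] at h₀
  refine ⟨?_, .inr ?_⟩
  · simp only [Multiset.forall_mem_cons]
    exact ⟨ne_zero_left_of_sympForm hab, ne_zero_right_of_sympForm hab, h₀.2⟩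
  have ⟨y, hy, hyR⟩ : ∃ y ∈ R, Transverse deg ((a * b) ::ₘ R) y := by
    rcases Multiset.mem_cons.mp hx with rfl | hx
    · exact hxR.exists_of_cons
    · exact ⟨x, hx, hxR⟩
  exact ⟨y, by simp [hy], (transverse_mul_cons_iff hd).mp hyR⟩

theorem MergesTo.mergeable (hd : IsSympMagma deg) (h : MergesTo deg S v) (hS : 2 ≤ S.card) :
    Mergeable deg S := by
  induction h with
  | single a => simp at hS
  | @merge a b R v hab _ ih =>
    rcases R.empty_or_exists_mem with rfl | ⟨x, hx⟩
    · exact mergeable_pair hab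
    · refine (ih ?_).of_mul_cons hd hab
      have := Multiset.card_pos_iff_exists_mem.mpr ⟨x, hx⟩
      rw [Multiset.card_cons]
      omega

theorem Mergeable.mul_cons (hd : IsSympMagma deg) (h₀ : ∀ x ∈ R, deg x ≠ 0)
    (hab : sympForm (deg a) (deg b) ≠ 0)
    (h : R = 0 ∨ Transverse deg (a ::ₘ b ::ₘ R) (a * b) ∨
      ∃ x ∈ R, Transverse deg (a ::ₘ b ::ₘ R) x) : Mergeable deg ((a * b) ::ₘ R) := by
  refine ⟨?_, ?_⟩
  · rw [Multiset.forall_mem_cons, hd.deg_mul]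
    exact ⟨add_ne_zero_of_sympForm hab, h₀⟩
  · simp only [transverse_mul_cons_iff hd]
    rcases h with rfl | hab' | ⟨x, hx, hx'⟩
    · exact .inl rfl
    · exact .inr ⟨a * b, by simp, hab'⟩
    · exact .inr ⟨x, by simp [hx], hx'⟩

theorem Mergeable.nonempty_mergeResults [NoZeroDivisors k] (hd : IsSympMagma deg)
    (h : Mergeable deg S) : (mergeResults deg S).Nonempty := by
  induction hn : S.card using Nat.strong_induction_on generalizing S with
  | _ n ih =>
  rcases (by omega : S.card = 0 ∨ S.card = 1 ∨ 2 ≤ S.card) with hS | hS | hS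
  · obtain rfl := Multiset.card_eq_zero.mp hS
    simp [Mergeable] at h
  · obtain ⟨a, rfl⟩ := Multiset.card_eq_one.mp hS
    exact ⟨a, .single a⟩
  · obtain ⟨a, b, R, rfl, hab, hR⟩ := h.exists_sympForm_ne_zero hS
    have hmul : Mergeable deg ((a * b) ::ₘ R) :=
      .mul_cons hd (fun x hx => h.1 x (by simp [hx])) hab (hR.imp_right .inr)
    obtain ⟨v, hv⟩ := ih _ (by simp [← hn]) hmul rfl
    exact ⟨v, .merge hab hv⟩

end Merging

section MergeStep

variable {k : Type*} [CommRing k] {H : Type*} [Mul H] {deg : H → k × k}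
  {S R W : Multiset H} {a b c d x z : H}

/-- The setting of the inductive step in the proof that merge results are unique: `S` consists of
elements of nonzero degree, and smaller multisets have at most one merge result. -/
structure UniqueBelow (deg : H → k × k) (S : Multiset H) : Prop where
  magma : IsSympMagma deg
  deg_ne_zero : ∀ x ∈ S, deg x ≠ 0
  unique : ∀ T : Multiset H, T.card < S.card → (mergeResults deg T).Subsingleton

/-- The results of those mergings of `S` which multiply `a` and `b` first. -/
def mergeResultsFrom (deg : H → k × k) (S : Multiset H) (a b : H) : Set H :=
  {v | ∃ R, S = a ::ₘ b ::ₘ R ∧ MergesTo deg ((a * b) ::ₘ R) v}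

theorem mergeResultsFrom_eq (hS : S = a ::ₘ b ::ₘ R) :
    mergeResultsFrom deg S a b = mergeResults deg ((a * b) ::ₘ R) := by
  subst hS
  simp only [mergeResultsFrom, mergeResults, Multiset.cons_inj_right, exists_eq_left']

namespace UniqueBelow

variable (hU : UniqueBelow deg S)
include hU

theorem mergeResultsFrom_comm (a b : H) :
    mergeResultsFrom deg S a b = mergeResultsFrom deg S b a := by
  simp only [mergeResultsFrom, hU.magma.mul_comm a b, Multiset.cons_swap a b]

variable [NoZeroDivisors k]

theorem mergeResults_mul_cons {T : Multiset H} (hT : T.card < S.card) (hTR : T = a ::ₘ b ::ₘ R)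
    (hab : sympForm (deg a) (deg b) ≠ 0) (hR : Mergeable deg ((a * b) ::ₘ R)) :
    mergeResults deg T = mergeResults deg ((a * b) ::ₘ R) := by
  have hsub : mergeResults deg ((a * b) ::ₘ R) ⊆ mergeResults deg T := fun v hv =>
    hTR ▸ MergesTo.merge hab hv
  refine subset_antisymm (fun w hw => ?_) hsub
  obtain ⟨v, hv⟩ := hR.nonempty_mergeResults hU.magma
  rwa [hU.unique T hT hw (hsub hv)]

theorem mergeResultsFrom_eq_of_mul_cons {T : Multiset H} (hS : S = a ::ₘ b ::ₘ R)
    (hR : (a * b) ::ₘ R = c ::ₘ d ::ₘ T) (hcd : sympForm (deg c) (deg d) ≠ 0)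
    (hT : Mergeable deg ((c * d) ::ₘ T)) :
    mergeResultsFrom deg S a b = mergeResults deg ((c * d) ::ₘ T) :=
  (mergeResultsFrom_eq hS).trans (hU.mergeResults_mul_cons (by simp [hS]) hR hcd hT)

theorem exchange_disjoint_of_transverse (hS : S = a ::ₘ b ::ₘ c ::ₘ d ::ₘ W)
    (hab : sympForm (deg a) (deg b) ≠ 0) (hcd : sympForm (deg c) (deg d) ≠ 0)
    (hW : Transverse deg S (a * b) ∨ ∃ x ∈ W, Transverse deg S x) :
    mergeResultsFrom deg S a b = mergeResultsFrom deg S c d := by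
  have hS' : S = c ::ₘ d ::ₘ a ::ₘ b ::ₘ W := hS.trans (by simp only [Multiset.cons_swap])
  have hmul : Mergeable deg ((a * b) ::ₘ (c * d) ::ₘ W) := by
    subst hS
    have hcdW : ∀ x ∈ (c * d) ::ₘ W, deg x ≠ 0 := by
      rw [Multiset.forall_mem_cons, hU.magma.deg_mul]
      exact ⟨add_ne_zero_of_sympForm hcd, fun x hx => hU.deg_ne_zero x (by simp [hx])⟩
    refine .mul_cons hU.magma hcdW hab (.inr ?_)
    rw [show a ::ₘ b ::ₘ (c * d) ::ₘ W = (c * d) ::ₘ a ::ₘ b ::ₘ W by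
      simp only [Multiset.cons_swap]]
    simp only [transverse_mul_cons_iff hU.magma, Multiset.mem_cons]
    rw [show c ::ₘ d ::ₘ a ::ₘ b ::ₘ W = a ::ₘ b ::ₘ c ::ₘ d ::ₘ W by
      simp only [Multiset.cons_swap]]
    exact hW.imp_right fun ⟨x, hx, hxS⟩ => ⟨x, .inr hx, hxS⟩
  calc mergeResultsFrom deg S a b
      = mergeResults deg ((c * d) ::ₘ (a * b) ::ₘ W) :=
        hU.mergeResultsFrom_eq_of_mul_cons hS (by simp only [Multiset.cons_swap]) hcd
          (by rwa [Multiset.cons_swap])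
    _ = mergeResults deg ((a * b) ::ₘ (c * d) ::ₘ W) := by rw [Multiset.cons_swap]
    _ = mergeResultsFrom deg S c d :=
        (hU.mergeResultsFrom_eq_of_mul_cons hS' (by simp only [Multiset.cons_swap]) hab
          hmul).symm

theorem exchange_of_cubic (hS : S = a ::ₘ b ::ₘ c ::ₘ W)
    (hab : sympForm (deg a) (deg b) ≠ 0) (hac : sympForm (deg a) (deg c) ≠ 0)
    (habc : sympForm (deg a + deg b) (deg c) ≠ 0) (hacb : sympForm (deg a + deg c) (deg b) ≠ 0)
    (hW : W = 0 ∨ ∃ x ∈ W, Transverse deg S x) :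
    mergeResultsFrom deg S a b = mergeResultsFrom deg S a c := by
  have heq : a * b * c = a * c * b := hU.magma.cubic a b c hab habc hac hacb
  rw [← hU.magma.deg_mul] at habc hacb
  have hmul : Mergeable deg ((a * b * c) ::ₘ W) := by
    subst hS
    refine .mul_cons hU.magma (fun x hx => hU.deg_ne_zero x (by simp [hx])) habc ?_
    simp only [transverse_mul_cons_iff hU.magma]
    exact hW.imp_right .inr
  rw [hU.mergeResultsFrom_eq_of_mul_cons hS rfl habc hmul,
    hU.mergeResultsFrom_eq_of_mul_cons (hS.trans (by simp only [Multiset.cons_swap])) rfl hacb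
      (heq ▸ hmul), heq]

theorem exchange_of_quartic (hS : S = a ::ₘ b ::ₘ c ::ₘ d ::ₘ 0)
    (hab : sympForm (deg a) (deg b) ≠ 0) (hac : sympForm (deg a) (deg c) ≠ 0)
    (habd : sympForm (deg a + deg b) (deg d) ≠ 0) (hacd : sympForm (deg a + deg c) (deg d) ≠ 0)
    (hb : Transverse deg S b) (hc : Transverse deg S c) :
    mergeResultsFrom deg S a b = mergeResultsFrom deg S a c := by
  have habdc : sympForm (deg a + deg b + deg d) (deg c) ≠ 0 := by
    simpa [Transverse, hS, sympForm_add_left, sympForm_self, add_assoc] using hc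
  have hacdb : sympForm (deg a + deg c + deg d) (deg b) ≠ 0 := by
    simpa [Transverse, hS, sympForm_add_left, sympForm_self, add_assoc] using hb
  have heq : a * b * d * c = a * c * d * b :=
    hU.magma.quartic a b d c hab habd habdc hac hacd hacdb
  simp only [← hU.magma.deg_mul] at habd hacd habdc hacdb
  have hS' : S = a ::ₘ c ::ₘ b ::ₘ d ::ₘ 0 := hS.trans (by simp only [Multiset.cons_swap])
  calc mergeResultsFrom deg S a b
      = mergeResults deg ((a * b * d) ::ₘ c ::ₘ 0) :=
        hU.mergeResultsFrom_eq_of_mul_cons hS (by simp only [Multiset.cons_swap]) habd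
          (mergeable_pair habdc)
    _ = mergeResults deg ((a * b * d * c) ::ₘ 0) :=
        hU.mergeResults_mul_cons (by simp [hS]) rfl habdc
          (.mul_cons hU.magma (by simp) habdc (.inl rfl))
    _ = mergeResults deg ((a * c * d * b) ::ₘ 0) := by rw [heq]
    _ = mergeResults deg ((a * c * d) ::ₘ b ::ₘ 0) :=
        (hU.mergeResults_mul_cons (by simp [hS]) rfl hacdb
          (.mul_cons hU.magma (by simp) hacdb (.inl rfl))).symm
    _ = mergeResultsFrom deg S a c :=
        (hU.mergeResultsFrom_eq_of_mul_cons hS' (by simp only [Multiset.cons_swap]) hacd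
          (mergeable_pair hacdb)).symm

end UniqueBelow

end MergeStep

section FourElements

variable {k : Type*} [CommRing k] {H : Type*} {deg : H → k × k} {S R : Multiset H} {a b c d x : H}

theorem transverse_four_iff (hS : S = a ::ₘ b ::ₘ c ::ₘ d ::ₘ 0) :
    Transverse deg S x ↔ sympForm (deg a) (deg x) + sympForm (deg b) (deg x) +
      sympForm (deg c) (deg x) + sympForm (deg d) (deg x) ≠ 0 := by
  simp [Transverse, hS, sympForm_add_left, add_assoc]

theorem transverse_last_iff (hS : S = a ::ₘ b ::ₘ c ::ₘ d ::ₘ 0) :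
    Transverse deg S d ↔ sympForm (deg a + deg b + deg c) (deg d) ≠ 0 := by
  simp [Transverse, hS, sympForm_add_left, sympForm_self, add_assoc]

variable [Mul H]

namespace UniqueBelow

variable [NoZeroDivisors k] (hU : UniqueBelow deg S)
include hU

-- Since `a * b` and `c` have parallel degrees, the cubic law cannot exchange `b` and `c` next to
-- `a`; but it can exchange `a` and `b` next to `c`.
theorem exchange_of_cubic_of_parallel {v : k × k} (hS : S = a ::ₘ b ::ₘ c ::ₘ R)
    (hab : sympForm (deg a) (deg b) ≠ 0) (hac : sympForm (deg a) (deg c) ≠ 0)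
    (habc : sympForm (deg a + deg b) (deg c) = 0)
    (hv : sympForm (deg a + deg b + deg c) v ≠ 0) (hR : ∃ x ∈ R, Transverse deg S x) :
    mergeResultsFrom deg S c a = mergeResultsFrom deg S c b := by
  obtain ⟨-, -, ha_bc⟩ := sympForm_ne_zero_of_add_parallel hab hac habc hv
  apply hU.exchange_of_cubic (hS.trans (by simp only [Multiset.cons_swap])) (W := R)
  · exact sympForm_ne_zero_comm.mp hac
  · grind [sympForm_swap, sympForm_add_left]
  · grind [sympForm_swap, sympForm_add_left, sympForm_add_right]
  · grind [sympForm_swap, sympForm_add_left, sympForm_add_right]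
  · exact .inr hR

variable (hS : S = a ::ₘ b ::ₘ c ::ₘ d ::ₘ 0) (hab : sympForm (deg a) (deg b) ≠ 0)
  (hac : sympForm (deg a) (deg c) ≠ 0)
include hS hab hac

section Parallel

variable (habc : sympForm (deg a + deg b) (deg c) = 0) (hd : Transverse deg S d)
include habc hd

theorem exchange_of_quartic_of_parallel (hacd : sympForm (deg a + deg c) (deg d) ≠ 0)
    (hb : Transverse deg S b) : mergeResultsFrom deg S a b = mergeResultsFrom deg S a c := by
  obtain ⟨hcd, habd, -⟩ :=
    sympForm_ne_zero_of_add_parallel hab hac habc ((transverse_last_iff hS).mp hd)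
  apply hU.exchange_of_quartic hS hab hac habd hacd hb
  grind [transverse_four_iff, sympForm_swap, sympForm_add_left, sympForm_self]

theorem exchange_of_disjoint_of_parallel (hbcd : sympForm (deg b + deg c) (deg d) = 0)
    (ha : Transverse deg S a)
    (h : ¬ Transverse deg S b ∨ sympForm (deg a + deg c) (deg d) = 0) :
    mergeResultsFrom deg S a b = mergeResultsFrom deg S a c := by
  obtain ⟨hcd, habd, ha_bc⟩ :=
    sympForm_ne_zero_of_add_parallel hab hac habc ((transverse_last_iff hS).mp hd)
  have hS₁ : S = d ::ₘ c ::ₘ b ::ₘ a ::ₘ 0 := hS.trans (by simp only [Multiset.cons_swap])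
  have hS₂ : S = b ::ₘ d ::ₘ a ::ₘ c ::ₘ 0 := hS.trans (by simp only [Multiset.cons_swap])
  have hdbc : sympForm (deg d + deg b) (deg c) ≠ 0 := by
    intro hdbc
    rw [transverse_four_iff hS] at ha
    refine mul_ne_zero hac ha ?_
    have := sympForm_pluecker (deg a) (deg b) (deg c) (deg d)
    grind [sympForm_swap, sympForm_add_left, sympForm_self]
  have hbd : Transverse deg S (b * d) := by
    rw [transverse_four_iff hS] at *
    rw [hU.magma.deg_mul]
    rcases h with h | h <;>
      grind [sympForm_swap, sympForm_add_left, sympForm_self, sympForm_add_right]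
  have hdb : sympForm (deg d) (deg b) ≠ 0 := by grind [sympForm_swap, sympForm_add_left]
  have hdcb : sympForm (deg d + deg c) (deg b) ≠ 0 := by
    grind [sympForm_swap, sympForm_add_left]
  calc mergeResultsFrom deg S a b
      = mergeResultsFrom deg S c d := hU.exchange_disjoint_of_transverse hS hab hcd (.inl ?_)
    _ = mergeResultsFrom deg S d c := hU.mergeResultsFrom_comm c d
    _ = mergeResultsFrom deg S d b :=
        hU.exchange_of_cubic hS₁ (sympForm_ne_zero_comm.mp hcd) hdb hdcb hdbc
          (.inr ⟨a, by simp, ha⟩)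
    _ = mergeResultsFrom deg S b d := hU.mergeResultsFrom_comm d b
    _ = mergeResultsFrom deg S a c :=
        hU.exchange_disjoint_of_transverse hS₂ (sympForm_ne_zero_comm.mp hdb) hac (.inl hbd)
  rw [transverse_four_iff hS] at *
  rw [hU.magma.deg_mul]
  grind [sympForm_swap, sympForm_add_left, sympForm_self, sympForm_add_right]

theorem exchange_shared_of_parallel : mergeResultsFrom deg S a b = mergeResultsFrom deg S a c := by
  have hS' : S = b ::ₘ a ::ₘ c ::ₘ d ::ₘ 0 := hS.trans (by simp only [Multiset.cons_swap])
  have hba := sympForm_ne_zero_comm.mp hab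
  have hbc : sympForm (deg b) (deg c) ≠ 0 := by grind [sympForm_add_left]
  have hbac : sympForm (deg b + deg a) (deg c) = 0 := by rwa [add_comm]
  have hca_cb :=
    hU.exchange_of_cubic_of_parallel hS hab hac habc ((transverse_last_iff hS).mp hd)
      ⟨d, by simp, hd⟩
  have of_swap (h : mergeResultsFrom deg S b a = mergeResultsFrom deg S b c) :
      mergeResultsFrom deg S a b = mergeResultsFrom deg S a c := by
    rw [hU.mergeResultsFrom_comm a b, h, hU.mergeResultsFrom_comm b c, ← hca_cb,
      hU.mergeResultsFrom_comm c a]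
  have ha_or_hb := hd.or_of_sympForm_ne_zero hab
  by_cases hqa : Transverse deg S b ∧ sympForm (deg a + deg c) (deg d) ≠ 0
  · exact hU.exchange_of_quartic_of_parallel hS hab hac habc hd hqa.2 hqa.1
  by_cases hqb : Transverse deg S a ∧ sympForm (deg b + deg c) (deg d) ≠ 0
  · exact of_swap (hU.exchange_of_quartic_of_parallel hS' hba hbc hbac hd hqb.2 hqb.1)
  by_cases ha : Transverse deg S a
  · exact hU.exchange_of_disjoint_of_parallel hS hab hac habc hd (by tauto) ha (by tauto)
  · exact of_swap
      (hU.exchange_of_disjoint_of_parallel hS' hba hbc hbac hd (by tauto) (by tauto) (.inl ha))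

end Parallel

theorem exchange_shared_four (hcd : Transverse deg S c ∨ Transverse deg S d)
    (hbd : Transverse deg S b ∨ Transverse deg S d) :
    mergeResultsFrom deg S a b = mergeResultsFrom deg S a c := by
  have hS' : S = a ::ₘ c ::ₘ b ::ₘ d ::ₘ 0 := hS.trans (by simp only [Multiset.cons_swap])
  by_cases hd : Transverse deg S d
  · by_cases habc : sympForm (deg a + deg b) (deg c) = 0
    · exact hU.exchange_shared_of_parallel hS hab hac habc hd
    by_cases hacb : sympForm (deg a + deg c) (deg b) = 0
    · exact (hU.exchange_shared_of_parallel hS' hac hab hacb hd).symm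
    exact hU.exchange_of_cubic hS hab hac habc hacb (.inr ⟨d, by simp, hd⟩)
  · have hb := hbd.resolve_right hd
    have hc := hcd.resolve_right hd
    have hd₀ : deg d ≠ 0 := hU.deg_ne_zero d (by simp [hS])
    have hdb := sympForm_ne_zero_of_parallel hd₀ (not_not.mp hd) hb
    have hdc := sympForm_ne_zero_of_parallel hd₀ (not_not.mp hd) hc
    rw [transverse_four_iff hS, not_not] at hd
    refine hU.exchange_of_quartic hS hab hac ?_ ?_ hb hc <;>
      grind [sympForm_swap, sympForm_add_left, sympForm_self]

end UniqueBelow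

end FourElements

section Exchange

variable {k : Type*} [CommRing k] {H : Type*} [Mul H] {deg : H → k × k}
  {S W : Multiset H} {a b c d e z : H}

namespace UniqueBelow

variable (hU : UniqueBelow deg S)
include hU

theorem transverse_of_not_transverse_mul (hS : S = a ::ₘ b ::ₘ c ::ₘ d ::ₘ W)
    (ha_or_hb : Transverse deg S a ∨ Transverse deg S b)
    (hc_or_hd : Transverse deg S c ∨ Transverse deg S d)
    (hmul : ¬Transverse deg S (a * b)) (hW : ∀ x ∈ W, ¬Transverse deg S x) :
    Transverse deg S a ∧ Transverse deg S b ∧ Transverse deg S c ∧ Transverse deg S d := by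
  have hself : sympForm (S.map deg).sum
      (deg a + deg b + (deg c + deg d) + (W.map deg).sum) = 0 := by
    simpa [hS, add_assoc] using sympForm_self (S.map deg).sum
  have hsumW : sympForm (S.map deg).sum (W.map deg).sum = 0 :=
    sympForm_eq_zero_of_forall_mem fun x hx => not_not.mp (hW x hx)
  simp only [Transverse, hU.magma.deg_mul, sympForm_add_right] at *
  grind

variable [NoZeroDivisors k]

theorem exchange_disjoint_four (hS : S = a ::ₘ b ::ₘ c ::ₘ d ::ₘ 0)
    (hab : sympForm (deg a) (deg b) ≠ 0) (hcd : sympForm (deg c) (deg d) ≠ 0)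
    (ha_or_hb : Transverse deg S a ∨ Transverse deg S b)
    (hc_or_hd : Transverse deg S c ∨ Transverse deg S d) :
    mergeResultsFrom deg S a b = mergeResultsFrom deg S c d := by
  by_cases hmul : Transverse deg S (a * b)
  · exact hU.exchange_disjoint_of_transverse hS hab hcd (.inl hmul)
  obtain ⟨-, hb, hc, hd⟩ :=
    hU.transverse_of_not_transverse_mul hS ha_or_hb hc_or_hd hmul (by simp)
  have cross {x y : H} (hS : S = a ::ₘ b ::ₘ x ::ₘ y ::ₘ 0)
      (hxy : sympForm (deg x) (deg y) ≠ 0) (hy : Transverse deg S y)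
      (hax : sympForm (deg a) (deg x) ≠ 0) :
      mergeResultsFrom deg S a b = mergeResultsFrom deg S x y := by
    have hS' : S = x ::ₘ a ::ₘ y ::ₘ b ::ₘ 0 := hS.trans (by simp only [Multiset.cons_swap])
    rw [hU.exchange_shared_four hS hab hax (.inr hy) (.inr hy), hU.mergeResultsFrom_comm a x,
      hU.exchange_shared_four hS' (sympForm_ne_zero_comm.mp hax) hxy (.inr hb) (.inr hb)]
  by_cases hac : sympForm (deg a) (deg c) = 0
  · have had : sympForm (deg a) (deg d) ≠ 0 :=
      sympForm_ne_zero_of_parallel (ne_zero_left_of_sympForm hab)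
        (by rw [sympForm_swap, hac, neg_zero]) hcd
    rw [cross (hS.trans (by simp only [Multiset.cons_swap])) (sympForm_ne_zero_comm.mp hcd) hc had,
      hU.mergeResultsFrom_comm]
  · exact cross hS hcd hd hac

theorem exchange_disjoint_of_cross (hS : S = a ::ₘ b ::ₘ c ::ₘ d ::ₘ z ::ₘ W)
    (hab : sympForm (deg a) (deg b) ≠ 0) (hcd : sympForm (deg c) (deg d) ≠ 0)
    (hbc : sympForm (deg b) (deg c) ≠ 0) (ha : Transverse deg S a) (hb : Transverse deg S b)
    (hc : Transverse deg S c) (hd : Transverse deg S d) (hz : ¬Transverse deg S z) :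
    mergeResultsFrom deg S a b = mergeResultsFrom deg S c d := by
  have hz₀ : deg z ≠ 0 := hU.deg_ne_zero z (by simp [hS])
  have hza := sympForm_ne_zero_of_parallel hz₀ (not_not.mp hz) ha
  have hzd := sympForm_ne_zero_of_parallel hz₀ (not_not.mp hz) hd
  calc mergeResultsFrom deg S a b
      = mergeResultsFrom deg S z d := hU.exchange_disjoint_of_transverse (W := c ::ₘ W)
        (hS.trans (by simp only [Multiset.cons_swap])) hab hzd (.inr ⟨c, by simp, hc⟩)
    _ = mergeResultsFrom deg S b c := hU.exchange_disjoint_of_transverse (W := a ::ₘ W)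
        (hS.trans (by simp only [Multiset.cons_swap])) hzd hbc (.inr ⟨a, by simp, ha⟩)
    _ = mergeResultsFrom deg S z a := hU.exchange_disjoint_of_transverse (W := d ::ₘ W)
        (hS.trans (by simp only [Multiset.cons_swap])) hbc hza (.inr ⟨d, by simp, hd⟩)
    _ = mergeResultsFrom deg S c d := hU.exchange_disjoint_of_transverse (W := b ::ₘ W)
        (hS.trans (by simp only [Multiset.cons_swap])) hza hcd (.inr ⟨b, by simp, hb⟩)

theorem exchange_disjoint (hS : S = a ::ₘ b ::ₘ c ::ₘ d ::ₘ W)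
    (hab : sympForm (deg a) (deg b) ≠ 0) (hcd : sympForm (deg c) (deg d) ≠ 0)
    (habW : ∃ x ∈ a ::ₘ b ::ₘ W, Transverse deg S x)
    (hcdW : ∃ x ∈ c ::ₘ d ::ₘ W, Transverse deg S x) :
    mergeResultsFrom deg S a b = mergeResultsFrom deg S c d := by
  by_cases hW : ∃ x ∈ W, Transverse deg S x
  · exact hU.exchange_disjoint_of_transverse hS hab hcd (.inr hW)
  have ha_or_hb : Transverse deg S a ∨ Transverse deg S b := by
    simpa [or_and_right, exists_or, hW] using habW
  have hc_or_hd : Transverse deg S c ∨ Transverse deg S d := by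
    simpa [or_and_right, exists_or, hW] using hcdW
  rcases W.empty_or_exists_mem with rfl | ⟨z, hz⟩
  · exact hU.exchange_disjoint_four hS hab hcd ha_or_hb hc_or_hd
  by_cases hmul : Transverse deg S (a * b)
  · exact hU.exchange_disjoint_of_transverse hS hab hcd (.inl hmul)
  push Not at hW
  obtain ⟨ha, hb, hc, hd⟩ := hU.transverse_of_not_transverse_mul hS ha_or_hb hc_or_hd hmul hW
  have hzS := hW z hz
  obtain ⟨W, rfl⟩ := Multiset.exists_cons_of_mem hz
  by_cases hbc : sympForm (deg b) (deg c) = 0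
  · have hbd : sympForm (deg b) (deg d) ≠ 0 :=
      sympForm_ne_zero_of_parallel (ne_zero_right_of_sympForm hab)
        (by rw [sympForm_swap, hbc, neg_zero]) hcd
    have hS' : S = a ::ₘ b ::ₘ d ::ₘ c ::ₘ z ::ₘ W := hS.trans (by simp only [Multiset.cons_swap])
    rw [hU.exchange_disjoint_of_cross hS' hab (sympForm_ne_zero_comm.mp hcd) hbd ha hb hd hc hzS,
      hU.mergeResultsFrom_comm]
  · exact hU.exchange_disjoint_of_cross hS hab hcd hbc ha hb hc hd hzS

theorem exchange_shared_of_forall_not_transverse (hS : S = a ::ₘ b ::ₘ c ::ₘ d ::ₘ e ::ₘ W)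
    (hab : sympForm (deg a) (deg b) ≠ 0) (hac : sympForm (deg a) (deg c) ≠ 0)
    (hb : Transverse deg S b) (hc : Transverse deg S c)
    (hd : ¬Transverse deg S d) (he : ¬Transverse deg S e) :
    mergeResultsFrom deg S a b = mergeResultsFrom deg S a c := by
  have hdc := sympForm_ne_zero_of_parallel (hU.deg_ne_zero d (by simp [hS])) (not_not.mp hd) hc
  have heb := sympForm_ne_zero_of_parallel (hU.deg_ne_zero e (by simp [hS])) (not_not.mp he) hb
  calc mergeResultsFrom deg S a b
      = mergeResultsFrom deg S d c := hU.exchange_disjoint (W := e ::ₘ W)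
        (hS.trans (by simp only [Multiset.cons_swap])) hab hdc ⟨b, by simp, hb⟩ ⟨c, by simp, hc⟩
    _ = mergeResultsFrom deg S e b := hU.exchange_disjoint (W := a ::ₘ W)
        (hS.trans (by simp only [Multiset.cons_swap])) hdc heb ⟨c, by simp, hc⟩ ⟨b, by simp, hb⟩
    _ = mergeResultsFrom deg S a c := hU.exchange_disjoint (W := d ::ₘ W)
        (hS.trans (by simp only [Multiset.cons_swap])) heb hac ⟨b, by simp, hb⟩ ⟨c, by simp, hc⟩

theorem exchange_shared_of_pair (hS : S = a ::ₘ b ::ₘ c ::ₘ d ::ₘ e ::ₘ W)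
    (hab : sympForm (deg a) (deg b) ≠ 0) (hac : sympForm (deg a) (deg c) ≠ 0)
    (hde : sympForm (deg d) (deg e) ≠ 0) (hR : ∃ x ∈ d ::ₘ e ::ₘ W, Transverse deg S x) :
    mergeResultsFrom deg S a b = mergeResultsFrom deg S a c := by
  obtain ⟨x, hx, hxS⟩ := hR
  have exists_mem_cons {y z : H} (hay : sympForm (deg a) (deg y) ≠ 0) :
      ∃ w ∈ a ::ₘ y ::ₘ z ::ₘ W, Transverse deg S w := by
    rcases hxS.or_of_sympForm_ne_zero hay with h | h
    exacts [⟨a, by simp, h⟩, ⟨y, by simp, h⟩]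
  have mem_cons (y : H) : x ∈ d ::ₘ e ::ₘ y ::ₘ W := by
    simp only [Multiset.mem_cons] at hx ⊢
    tauto
  calc mergeResultsFrom deg S a b
      = mergeResultsFrom deg S d e := hU.exchange_disjoint (W := c ::ₘ W)
        (hS.trans (by simp only [Multiset.cons_swap])) hab hde (exists_mem_cons hab)
        ⟨x, mem_cons c, hxS⟩
    _ = mergeResultsFrom deg S a c := hU.exchange_disjoint (W := b ::ₘ W)
        (hS.trans (by simp only [Multiset.cons_swap])) hde hac ⟨x, mem_cons b, hxS⟩
        (exists_mem_cons hac)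

theorem exchange_shared_of_collinear (hS : S = a ::ₘ b ::ₘ c ::ₘ d ::ₘ e ::ₘ W)
    (hab : sympForm (deg a) (deg b) ≠ 0) (hac : sympForm (deg a) (deg c) ≠ 0)
    (habc : sympForm (deg a + deg b) (deg c) = 0)
    (habcd : sympForm (deg a + deg b + deg c) (deg d) ≠ 0) (hde : sympForm (deg d) (deg e) = 0)
    (hd : Transverse deg S d) (he : Transverse deg S e) :
    mergeResultsFrom deg S a b = mergeResultsFrom deg S a c := by
  have hd₀ : deg d ≠ 0 := hU.deg_ne_zero d (by simp [hS])
  have hcd : sympForm (deg c) (deg d) ≠ 0 :=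
    (sympForm_ne_zero_of_add_parallel hab hac habc habcd).1
  have off_line {y : H} (hyd : sympForm (deg y) (deg d) ≠ 0) :
      sympForm (deg y) (deg e) ≠ 0 := fun hye =>
    hyd (sympForm_eq_zero_trans (hU.deg_ne_zero e (by simp [hS])) hye
      (by rw [sympForm_swap, hde, neg_zero]))
  by_cases hbd : sympForm (deg b) (deg d) = 0
  · have hcb : sympForm (deg c) (deg b) ≠ 0 := by grind [sympForm_add_left, sympForm_swap]
    have had : sympForm (deg a) (deg d) ≠ 0 := fun had =>
      hab (sympForm_eq_zero_trans hd₀ had (by rw [sympForm_swap, hbd, neg_zero]))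
    calc mergeResultsFrom deg S a b
        = mergeResultsFrom deg S c e := hU.exchange_disjoint (W := d ::ₘ W)
          (hS.trans (by simp only [Multiset.cons_swap])) hab (off_line hcd) ⟨d, by simp, hd⟩
          ⟨d, by simp, hd⟩
      _ = mergeResultsFrom deg S a d := hU.exchange_disjoint (W := b ::ₘ W)
          (hS.trans (by simp only [Multiset.cons_swap])) (off_line hcd) had ⟨e, by simp, he⟩
          ⟨d, by simp, hd⟩
      _ = mergeResultsFrom deg S c b := hU.exchange_disjoint (W := e ::ₘ W)
          (hS.trans (by simp only [Multiset.cons_swap])) had hcb ⟨d, by simp, hd⟩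
          ⟨e, by simp, he⟩
      _ = mergeResultsFrom deg S c a :=
          (hU.exchange_of_cubic_of_parallel hS hab hac habc habcd ⟨d, by simp, hd⟩).symm
      _ = mergeResultsFrom deg S a c := hU.mergeResultsFrom_comm c a
  · calc mergeResultsFrom deg S a b
        = mergeResultsFrom deg S c d := hU.exchange_disjoint hS hab hcd ⟨e, by simp, he⟩
          ⟨d, by simp, hd⟩
      _ = mergeResultsFrom deg S b e := hU.exchange_disjoint (W := a ::ₘ W)
          (hS.trans (by simp only [Multiset.cons_swap])) hcd (off_line hbd) ⟨d, by simp, hd⟩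
          ⟨e, by simp, he⟩
      _ = mergeResultsFrom deg S a c := hU.exchange_disjoint (W := d ::ₘ W)
          (hS.trans (by simp only [Multiset.cons_swap])) (off_line hbd) hac ⟨e, by simp, he⟩
          ⟨d, by simp, hd⟩

theorem exchange_shared_of_parallel_of_two_le (hS : S = a ::ₘ b ::ₘ c ::ₘ W)
    (hab : sympForm (deg a) (deg b) ≠ 0) (hac : sympForm (deg a) (deg c) ≠ 0)
    (habc : sympForm (deg a + deg b) (deg c) = 0)
    (hW : ∃ x ∈ W, Transverse deg S x) (hcard : 2 ≤ W.card) :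
    mergeResultsFrom deg S a b = mergeResultsFrom deg S a c := by
  by_cases hpair : ∃ d e V, W = d ::ₘ e ::ₘ V ∧ sympForm (deg d) (deg e) ≠ 0
  · obtain ⟨d, e, V, rfl, hde⟩ := hpair
    exact hU.exchange_shared_of_pair hS hab hac hde hW
  obtain ⟨d, hdW, hd⟩ := hW
  obtain ⟨V, rfl⟩ := Multiset.exists_cons_of_mem hdW
  have hparallel : ∀ y ∈ d ::ₘ V, sympForm (deg d) (deg y) = 0 := by
    simp only [Multiset.forall_mem_cons, sympForm_self, true_and]
    intro y hy
    by_contra hdy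
    obtain ⟨V, rfl⟩ := Multiset.exists_cons_of_mem hy
    exact hpair ⟨d, y, V, rfl, hdy⟩
  have habcd : sympForm (deg a + deg b + deg c) (deg d) ≠ 0 := by
    have hsum := sympForm_eq_zero_of_forall_mem hparallel
    rw [sympForm_swap, neg_eq_zero] at hsum
    have hsplit : (S.map deg).sum = deg a + deg b + deg c + ((d ::ₘ V).map deg).sum := by
      simp only [hS, Multiset.map_cons, Multiset.sum_cons, add_assoc]
    rwa [Transverse, hsplit, sympForm_add_left, hsum, add_zero] at hd
  obtain ⟨e, heV⟩ : ∃ e, e ∈ V := by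
    rw [← Multiset.card_pos_iff_exists_mem]
    simpa [Nat.succ_le_iff] using hcard
  obtain ⟨V, rfl⟩ := Multiset.exists_cons_of_mem heV
  have hde : sympForm (deg d) (deg e) = 0 := hparallel e (by simp)
  have he : Transverse deg S e := fun he =>
    hd (sympForm_eq_zero_trans (hU.deg_ne_zero e (by simp [hS])) he
      (by rw [sympForm_swap, hde, neg_zero]))
  exact hU.exchange_shared_of_collinear hS hab hac habc habcd hde hd he

theorem exchange_shared (hS : S = a ::ₘ b ::ₘ c ::ₘ W)
    (hab : sympForm (deg a) (deg b) ≠ 0) (hac : sympForm (deg a) (deg c) ≠ 0)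
    (hbW : ∃ x ∈ b ::ₘ W, Transverse deg S x) (hcW : ∃ x ∈ c ::ₘ W, Transverse deg S x) :
    mergeResultsFrom deg S a b = mergeResultsFrom deg S a c := by
  have hS' : S = a ::ₘ c ::ₘ b ::ₘ W := hS.trans (by simp only [Multiset.cons_swap])
  rcases W.empty_or_exists_mem with rfl | ⟨d, hdW⟩
  · refine hU.exchange_of_cubic hS hab hac ?_ ?_ (.inl rfl)
    · simpa [Transverse, hS, sympForm_add_left, sympForm_self] using hcW
    · simpa [Transverse, hS, sympForm_add_left, sympForm_self] using hbW
  obtain ⟨W, rfl⟩ := Multiset.exists_cons_of_mem hdW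
  rcases W.empty_or_exists_mem with rfl | ⟨e, heW⟩
  · exact hU.exchange_shared_four hS hab hac (by simpa using hcW) (by simpa using hbW)
  obtain ⟨W, rfl⟩ := Multiset.exists_cons_of_mem heW
  by_cases hW : ∃ x ∈ d ::ₘ e ::ₘ W, Transverse deg S x
  · by_cases habc : sympForm (deg a + deg b) (deg c) = 0
    · exact hU.exchange_shared_of_parallel_of_two_le hS hab hac habc hW (by simp)
    by_cases hacb : sympForm (deg a + deg c) (deg b) = 0
    · exact (hU.exchange_shared_of_parallel_of_two_le hS' hac hab hacb hW (by simp)).symm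
    exact hU.exchange_of_cubic hS hab hac habc hacb (.inr hW)
  · have of_cons {y : H} (hy : ∃ x ∈ y ::ₘ d ::ₘ e ::ₘ W, Transverse deg S x) :
        Transverse deg S y := by
      obtain ⟨x, hx, hxS⟩ := hy
      rcases Multiset.mem_cons.mp hx with rfl | hx
      exacts [hxS, (hW ⟨x, hx, hxS⟩).elim]
    push Not at hW
    exact hU.exchange_shared_of_forall_not_transverse hS hab hac (of_cons hbW) (of_cons hcW)
      (hW d (by simp)) (hW e (by simp))

end UniqueBelow

end Exchange

section MergeUnique

variable {k : Type*} [CommRing k] {H : Type*} [Mul H] {deg : H → k × k}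
  {S R W : Multiset H} {a b c d v : H}

theorem exists_transverse_of_nonempty_mergeResultsFrom (hd : IsSympMagma deg)
    (hS : S = a ::ₘ b ::ₘ R) (hR : R ≠ 0) (hne : (mergeResultsFrom deg S a b).Nonempty) :
    ∃ x ∈ R, Transverse deg S x := by
  rw [mergeResultsFrom_eq hS] at hne
  obtain ⟨v, hv⟩ := hne
  have hcard := Multiset.card_pos.mpr hR
  obtain ⟨-, hone | ⟨x, hx, hxR⟩⟩ := hv.mergeable hd (by rw [Multiset.card_cons]; omega)
  · rw [Multiset.card_cons] at hone
    omega
  have ⟨y, hy, hyR⟩ : ∃ y ∈ R, Transverse deg ((a * b) ::ₘ R) y := by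
    rcases Multiset.mem_cons.mp hx with rfl | hx
    exacts [hxR.exists_of_cons, ⟨x, hx, hxR⟩]
  exact ⟨y, hy, hS ▸ (transverse_mul_cons_iff hd).mp hyR⟩

namespace UniqueBelow

variable [NoZeroDivisors k] (hU : UniqueBelow deg S)
include hU

theorem mergeResultsFrom_eq_of_nonempty_of_shared (hS : S = a ::ₘ b ::ₘ c ::ₘ W)
    (hab : sympForm (deg a) (deg b) ≠ 0) (hac : sympForm (deg a) (deg c) ≠ 0)
    (hneab : (mergeResultsFrom deg S a b).Nonempty)
    (hneac : (mergeResultsFrom deg S a c).Nonempty) :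
    mergeResultsFrom deg S a b = mergeResultsFrom deg S a c :=
  have hS' : S = a ::ₘ c ::ₘ b ::ₘ W := hS.trans (by simp only [Multiset.cons_swap])
  hU.exchange_shared hS hab hac
    (exists_transverse_of_nonempty_mergeResultsFrom hU.magma hS' (by simp) hneac)
    (exists_transverse_of_nonempty_mergeResultsFrom hU.magma hS (by simp) hneab)

theorem mergeResultsFrom_eq_of_nonempty_of_mem {T : Multiset H} (hS : S = a ::ₘ b ::ₘ R)
    (hS' : S = a ::ₘ d ::ₘ T) (hab : sympForm (deg a) (deg b) ≠ 0)
    (had : sympForm (deg a) (deg d) ≠ 0) (hneab : (mergeResultsFrom deg S a b).Nonempty)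
    (hnead : (mergeResultsFrom deg S a d).Nonempty) :
    mergeResultsFrom deg S a b = mergeResultsFrom deg S a d := by
  have hbd : b ::ₘ R = d ::ₘ T := (Multiset.cons_inj_right a).mp (hS.symm.trans hS')
  rcases Multiset.cons_eq_cons.mp hbd with ⟨rfl, -⟩ | ⟨-, W, rfl, -⟩
  · rfl
  · exact hU.mergeResultsFrom_eq_of_nonempty_of_shared hS hab had hneab hnead

theorem mergeResultsFrom_eq_of_nonempty {T : Multiset H} (hS : S = a ::ₘ b ::ₘ R)
    (hS' : S = c ::ₘ d ::ₘ T) (hab : sympForm (deg a) (deg b) ≠ 0)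
    (hcd : sympForm (deg c) (deg d) ≠ 0) (hneab : (mergeResultsFrom deg S a b).Nonempty)
    (hnecd : (mergeResultsFrom deg S c d).Nonempty) :
    mergeResultsFrom deg S a b = mergeResultsFrom deg S c d := by
  have hba := sympForm_ne_zero_comm.mp hab
  have hdc := sympForm_ne_zero_comm.mp hcd
  have hSba : S = b ::ₘ a ::ₘ R := hS.trans (Multiset.cons_swap ..)
  have hSdc : S = d ::ₘ c ::ₘ T := hS'.trans (Multiset.cons_swap ..)
  by_cases hac : a = c
  · subst hac
    exact hU.mergeResultsFrom_eq_of_nonempty_of_mem hS hS' hab hcd hneab hnecd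
  by_cases had : a = d
  · subst had
    rw [hU.mergeResultsFrom_comm c] at hnecd ⊢
    exact hU.mergeResultsFrom_eq_of_nonempty_of_mem hS hSdc hab hdc hneab hnecd
  rw [hU.mergeResultsFrom_comm a] at hneab ⊢
  by_cases hbc : b = c
  · subst hbc
    exact hU.mergeResultsFrom_eq_of_nonempty_of_mem hSba hS' hba hcd hneab hnecd
  by_cases hbd : b = d
  · subst hbd
    rw [hU.mergeResultsFrom_comm c] at hnecd ⊢
    exact hU.mergeResultsFrom_eq_of_nonempty_of_mem hSba hSdc hba hdc hneab hnecd
  have hR : a ::ₘ b ::ₘ R = c ::ₘ d ::ₘ T := hS.symm.trans hS'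
  simp only [Multiset.cons_eq_cons, hac, hbc, Ne.symm had, ne_eq, not_false_eq_true, false_and,
    true_and, false_or] at hR
  obtain ⟨_, ⟨_, rfl, rfl⟩, _, rfl, hW⟩ := hR
  obtain ⟨-, W, rfl, rfl⟩ := (Multiset.cons_eq_cons.mp hW).resolve_left fun h => hbd h.1
  exact hU.exchange_disjoint hSba hba hcd
    (by simpa only [Multiset.cons_swap] using
      exists_transverse_of_nonempty_mergeResultsFrom hU.magma hS' (by simp) hnecd)
    (exists_transverse_of_nonempty_mergeResultsFrom hU.magma hSba (by simp) hneab)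

end UniqueBelow

theorem MergesTo.eq_singleton_or_mem_mergeResultsFrom (h : MergesTo deg S v) :
    S = {v} ∨ ∃ a b R, S = a ::ₘ b ::ₘ R ∧ sympForm (deg a) (deg b) ≠ 0 ∧
      v ∈ mergeResultsFrom deg S a b := by
  cases h with
  | single a => exact .inl rfl
  | @merge a b R v hab h => exact .inr ⟨a, b, R, rfl, hab, R, rfl, h⟩

theorem mergeResults_subsingleton [NoZeroDivisors k] (hd : IsSympMagma deg) (S : Multiset H) :
    (mergeResults deg S).Subsingleton := by
  induction hn : S.card using Nat.strong_induction_on generalizing S with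
  | _ n ih =>
  intro v hv w hw
  rcases (by omega : S.card ≤ 1 ∨ 2 ≤ S.card) with hcard | hcard
  · have eq_singleton {u : H} (hu : MergesTo deg S u) : S = {u} := by
      refine hu.eq_singleton_or_mem_mergeResultsFrom.resolve_right ?_
      rintro ⟨a, b, R, rfl, -⟩
      simp at hcard
    exact Multiset.singleton_inj.mp ((eq_singleton hv).symm.trans (eq_singleton hw))
  have hU : UniqueBelow deg S :=
    ⟨hd, (hv.mergeable hd hcard).1, fun T hT => ih T.card (hn ▸ hT) T rfl⟩
  have exists_pair {u : H} (hu : MergesTo deg S u) : ∃ a b R, S = a ::ₘ b ::ₘ R ∧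
      sympForm (deg a) (deg b) ≠ 0 ∧ u ∈ mergeResultsFrom deg S a b := by
    refine hu.eq_singleton_or_mem_mergeResultsFrom.resolve_left ?_
    rintro rfl
    simp at hcard
  obtain ⟨a, b, R, hS, hab, hvab⟩ := exists_pair hv
  obtain ⟨c, d, T, hS', hcd, hwcd⟩ := exists_pair hw
  rw [hU.mergeResultsFrom_eq_of_nonempty hS hS' hab hcd ⟨v, hvab⟩ ⟨w, hwcd⟩,
    mergeResultsFrom_eq hS'] at hvab
  rw [mergeResultsFrom_eq hS'] at hwcd
  exact hU.unique _ (by simp [hS']) hvab hwcd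

end MergeUnique

section GradedSubstitution

variable {K : Type*} [Field K] {G : Type*} [AddCommGroup G]

theorem lie_mem_of_mem_span {L : Type*} [LieRing L] [LieAlgebra K L] {s t : Set L}
    {P : Submodule K L} (hst : ∀ x ∈ s, ∀ y ∈ t, ⁅x, y⁆ ∈ P) {x y : L}
    (hx : x ∈ Submodule.span K s) (hy : y ∈ Submodule.span K t) : ⁅x, y⁆ ∈ P :=
  LinearMap.BilinMap.apply_apply_mem_of_mem_span P s t
    (LinearMap.mk₂ K (fun x y => ⁅x, y⁆) add_lie smul_lie lie_add lie_smul) hst x y hx hy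

theorem gvar_mem_freeComponent (i : ℕ) (g : G) : gvar K i g ∈ freeComponent K g :=
  Submodule.subset_span (.var i g)

theorem lie_mem_freeComponent {g h : G} {x y : FreeGradedLie K G} (hx : x ∈ freeComponent K g)
    (hy : y ∈ freeComponent K h) : ⁅x, y⁆ ∈ freeComponent K (g + h) :=
  lie_mem_of_mem_span (fun _ hx _ hy => Submodule.subset_span (.bracket hx hy)) hx hy

theorem lift_mem_of_mem_freeComponent {L : Type*} [LieRing L] [LieAlgebra K L]
    {Γ : G → Submodule K L} (hΓ : ∀ g h, ∀ x ∈ Γ g, ∀ y ∈ Γ h, ⁅x, y⁆ ∈ Γ (g + h))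
    {ψ : G × ℕ → L} (hψ : ∀ g i, ψ (g, i) ∈ Γ g) {g : G} {f : FreeGradedLie K G}
    (hf : f ∈ freeComponent K g) : FreeLieAlgebra.lift K ψ f ∈ Γ g := by
  refine (Submodule.span_le.mpr fun f hf => ?_ :
    freeComponent K g ≤ (Γ g).comap (FreeLieAlgebra.lift K ψ).toLinearMap) hf
  clear * - hf hΓ hψ
  change FreeLieAlgebra.lift K ψ f ∈ Γ g
  induction hf with
  | var i g => rw [gvar, FreeLieAlgebra.lift_of_apply]; exact hψ g i
  | bracket _ _ ha hb => rw [LieHom.map_lie]; exact hΓ _ _ _ ha _ hb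

theorem isGradedEnd_lift {ψ : G × ℕ → FreeGradedLie K G}
    (hψ : ∀ g i, ψ (g, i) ∈ freeComponent K g) : IsGradedEnd (FreeLieAlgebra.lift K ψ) :=
  fun _ _ => lift_mem_of_mem_freeComponent (fun _ _ _ hx _ hy => lie_mem_freeComponent hx hy) hψ

theorem exists_isGradedEnd_gvar_eq {g : ℕ → G} {x : ℕ → FreeGradedLie K G}
    (hx : ∀ i, x i ∈ freeComponent K (g i)) :
    ∃ φ, IsGradedEnd φ ∧ ∀ i, φ (gvar K i (g i)) = x i := by
  classical
  refine ⟨FreeLieAlgebra.lift K fun p => if p.1 = g p.2 then x p.2 else 0,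
    isGradedEnd_lift fun h i => ?_, fun i => ?_⟩
  · dsimp only
    split_ifs with h_eq
    exacts [h_eq ▸ hx i, zero_mem _]
  · rw [gvar, FreeLieAlgebra.lift_of_apply, if_pos rfl]

theorem span_isGradedMonomial :
    Submodule.span K {f : FreeGradedLie K G | ∃ g, IsGradedMonomial f g} = ⊤ := by
  set P := Submodule.span K {f : FreeGradedLie K G | ∃ g, IsGradedMonomial f g}
  have lie_mem {x y : FreeGradedLie K G} (hx : x ∈ P) (hy : y ∈ P) : ⁅x, y⁆ ∈ P := by
    refine lie_mem_of_mem_span ?_ hx hy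
    rintro a ⟨g, ha⟩ b ⟨h, hb⟩
    exact Submodule.subset_span ⟨g + h, .bracket ha hb⟩
  let S : LieSubalgebra K (FreeGradedLie K G) := { P with lie_mem' := lie_mem }
  let φ : FreeGradedLie K G →ₗ⁅K⁆ S := FreeLieAlgebra.lift K
    fun x => ⟨FreeLieAlgebra.of K x, Submodule.subset_span ⟨x.1, .var x.2 x.1⟩⟩
  have hφ : S.incl.comp φ = LieHom.id := FreeLieAlgebra.hom_ext fun x => by simp [φ]
  refine eq_top_iff.mpr fun f _ => ?_
  have hf : (φ f : FreeGradedLie K G) = f := LieHom.congr_fun hφ f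
  exact hf ▸ (φ f).2

section Identities

variable {L : Type*} [LieRing L] [LieAlgebra K L] {Γ : G → Submodule K L}

/-- The ideal whose elements are the graded identities `T_G(L)`. -/
def gradedIdentityIdeal (Γ : G → Submodule K L) : LieIdeal K (FreeGradedLie K G) where
  carrier := gradedIdentities Γ
  zero_mem' := fun _ _ => map_zero _
  add_mem' := fun hf hg a ha => by rw [map_add, hf a ha, hg a ha, add_zero]
  smul_mem' := fun r f hf a ha => by rw [map_smul, hf a ha, smul_zero]
  lie_mem := fun {x f} hf a ha => by
    have hfa : FreeLieAlgebra.lift K a f = 0 := hf a ha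
    rw [LieHom.map_lie, hfa, lie_zero]

theorem isTIdeal_gradedIdentityIdeal
    (hΓ : ∀ g h, ∀ x ∈ Γ g, ∀ y ∈ Γ h, ⁅x, y⁆ ∈ Γ (g + h)) : IsTIdeal (gradedIdentityIdeal Γ) := by
  intro φ hφ f hf a ha
  have hcomp : (FreeLieAlgebra.lift K a).comp φ =
      FreeLieAlgebra.lift K fun x => FreeLieAlgebra.lift K a (φ (FreeLieAlgebra.of K x)) :=
    FreeLieAlgebra.hom_ext fun x => by rw [FreeLieAlgebra.lift_of_apply, LieHom.comp_apply]
  rw [← LieHom.comp_apply, hcomp]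
  exact hf _ fun g i => lift_mem_of_mem_freeComponent hΓ ha (hφ g _ (gvar_mem_freeComponent i g))

end Identities

theorem tIdealSpan_le {S : Set (FreeGradedLie K G)} {I : LieIdeal K (FreeGradedLie K G)}
    (hI : IsTIdeal I) (hS : S ⊆ (I : Set (FreeGradedLie K G))) : tIdealSpan S ≤ I :=
  sInf_le ⟨hI, hS⟩

namespace IsTIdeal

variable {I : LieIdeal K (FreeGradedLie K G)} {g₁ g₂ g₃ g₄ : G} {x₁ x₂ x₃ x₄ : FreeGradedLie K G}
  {c : K} {f : FreeGradedLie K G}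

theorem exists_lieHom_gvar_eq (hI : IsTIdeal I) (hx₁ : x₁ ∈ freeComponent K g₁)
    (hx₂ : x₂ ∈ freeComponent K g₂) (hx₃ : x₃ ∈ freeComponent K g₃)
    (hx₄ : x₄ ∈ freeComponent K g₄) (hf : f ∈ I) :
    ∃ φ : FreeGradedLie K G →ₗ⁅K⁆ FreeGradedLie K G, φ f ∈ I ∧ φ (gvar K 1 g₁) = x₁ ∧
      φ (gvar K 2 g₂) = x₂ ∧ φ (gvar K 3 g₃) = x₃ ∧ φ (gvar K 4 g₄) = x₄ := by
  let g : ℕ → G := fun | 1 => g₁ | 2 => g₂ | 3 => g₃ | 4 => g₄ | _ => 0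
  let x : ℕ → FreeGradedLie K G := fun | 1 => x₁ | 2 => x₂ | 3 => x₃ | 4 => x₄ | _ => 0
  have hx : ∀ i, x i ∈ freeComponent K (g i) := by
    rintro (_ | _ | _ | _ | _ | _)
    exacts [zero_mem _, hx₁, hx₂, hx₃, hx₄, zero_mem _]
  obtain ⟨φ, hφ, hφx⟩ := exists_isGradedEnd_gvar_eq hx
  exact ⟨φ, hI φ hφ f hf, hφx 1, hφx 2, hφx 3, hφx 4⟩

theorem mem_of_gvar_mem (hI : IsTIdeal I) (hx₁ : x₁ ∈ freeComponent K g₁)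
    (hf : gvar K 1 g₁ ∈ I) : x₁ ∈ I := by
  obtain ⟨φ, hφf, rfl, -⟩ := hI.exists_lieHom_gvar_eq hx₁ (zero_mem (freeComponent K (0 : G)))
    (zero_mem (freeComponent K (0 : G))) (zero_mem (freeComponent K (0 : G))) hf
  exact hφf

theorem lie_mem_of_lie_gvar_mem (hI : IsTIdeal I) (hx₁ : x₁ ∈ freeComponent K g₁)
    (hx₂ : x₂ ∈ freeComponent K g₂) (hf : ⁅gvar K 1 g₁, gvar K 2 g₂⁆ ∈ I) : ⁅x₁, x₂⁆ ∈ I := by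
  obtain ⟨φ, hφf, rfl, rfl, -⟩ := hI.exists_lieHom_gvar_eq hx₁ hx₂
    (zero_mem (freeComponent K (0 : G))) (zero_mem (freeComponent K (0 : G))) hf
  rwa [← LieHom.map_lie]

theorem cubic_mem (hI : IsTIdeal I) (hx₁ : x₁ ∈ freeComponent K g₁)
    (hx₂ : x₂ ∈ freeComponent K g₂) (hx₃ : x₃ ∈ freeComponent K g₃)
    (hf : cubicPoly c g₁ g₂ g₃ ∈ I) : ⁅⁅x₁, x₃⁆, x₂⁆ - c • ⁅⁅x₁, x₂⁆, x₃⁆ ∈ I := by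
  obtain ⟨φ, hφf, rfl, rfl, rfl, -⟩ := hI.exists_lieHom_gvar_eq hx₁ hx₂ hx₃
    (zero_mem (freeComponent K (0 : G))) hf
  simpa only [cubicPoly, comm3, map_sub, map_smul, LieHom.map_lie] using hφf

theorem quartic_mem (hI : IsTIdeal I) (hx₁ : x₁ ∈ freeComponent K g₁)
    (hx₂ : x₂ ∈ freeComponent K g₂) (hx₃ : x₃ ∈ freeComponent K g₃)
    (hx₄ : x₄ ∈ freeComponent K g₄) (hf : quarticPoly c g₁ g₂ g₃ g₄ ∈ I) :
    ⁅⁅⁅x₄, x₁⁆, x₂⁆, x₃⁆ - c • ⁅⁅⁅x₄, x₃⁆, x₂⁆, x₁⁆ ∈ I := by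
  obtain ⟨φ, hφf, rfl, rfl, rfl, rfl⟩ := hI.exists_lieHom_gvar_eq hx₁ hx₂ hx₃ hx₄ hf
  simpa only [quarticPoly, comm4, map_sub, map_smul, LieHom.map_lie] using hφf

end IsTIdeal

end GradedSubstitution

section PauliSystem

variable {K : Type*} [Field K] {k : Type*} [CommRing k] {L : Type*} [LieRing L] [LieAlgebra K L]

/-- The abstract form of a Pauli grading, over the plane `k × k`: the component of degree `g ≠ 0`
is the line `K u_g`, that of degree `0` vanishes, and `[u_g, u_h] = c(g, h) u_{g + h}`, where the
structure constant `c(g, h)` vanishes exactly when `g` and `h` are orthogonal for the symplectic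
form. -/
structure IsPauliSystem (Γ : k × k → Submodule K L) (u : k × k → L) (c : k × k → k × k → K) :
    Prop where
  span : ∀ g, Γ g = Submodule.span K {u g}
  eq_zero_iff : ∀ g, u g = 0 ↔ g = 0
  lie : ∀ g h, ⁅u g, u h⁆ = c g h • u (g + h)
  coeff_eq_zero_iff : ∀ g h, c g h = 0 ↔ sympForm g h = 0

/-- The scalar `λ_{g,h,l}` of the cubic identity, in terms of the structure constants. -/
def cubicScalar (c : k × k → k × k → K) (g h l : k × k) : K :=
  c g l * c (g + l) h / (c g h * c (g + h) l)

/-- The scalar `λ_{(g₁,g₂,g₃,g₄)}` of the quartic identity, in terms of the structure constants. -/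
def quarticScalar (c : k × k → k × k → K) (g₁ g₂ g₃ g₄ : k × k) : K :=
  c g₄ g₁ * c (g₄ + g₁) g₂ * c (g₄ + g₁ + g₂) g₃ /
    (c g₄ g₃ * c (g₄ + g₃) g₂ * c (g₄ + g₃ + g₂) g₁)

/-- The evaluation of Lie polynomials at `x_i^g ↦ t_{g,i} u_g`. -/
noncomputable def scaledEval {G : Type*} (u : G → L) (t : G × ℕ → K) : FreeGradedLie K G →ₗ⁅K⁆ L :=
  FreeLieAlgebra.lift K fun x => t x • u x.1

theorem scaledEval_gvar {G : Type*} (u : G → L) (t : G × ℕ → K) (i : ℕ) (g : G) :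
    scaledEval u t (gvar K i g) = t (g, i) • u g := by
  rw [scaledEval, gvar, FreeLieAlgebra.lift_of_apply]

namespace IsPauliSystem

variable {Γ : k × k → Submodule K L} {u : k × k → L} {c : k × k → k × k → K}
  (hu : IsPauliSystem Γ u c) {g h l g₁ g₂ g₃ g₄ : k × k}
include hu

theorem mem_component_iff {x : L} : x ∈ Γ g ↔ ∃ r : K, r • u g = x := by
  rw [hu.span, Submodule.mem_span_singleton]

theorem mem_gradingSupport_iff : g ∈ gradingSupport Γ ↔ g ≠ 0 := by
  rw [gradingSupport, Set.mem_ofPred_eq, hu.span, Ne, Submodule.span_singleton_eq_bot,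
    hu.eq_zero_iff]

theorem lie_smul_smul (r s : K) (g h : k × k) :
    ⁅r • u g, s • u h⁆ = (r * s * c g h) • u (g + h) := by
  rw [smul_lie, lie_smul, hu.lie, smul_smul, smul_smul, mul_assoc]

theorem lie_mem (g h : k × k) (x : L) (hx : x ∈ Γ g) (y : L) (hy : y ∈ Γ h) :
    ⁅x, y⁆ ∈ Γ (g + h) := by
  rw [hu.mem_component_iff] at *
  obtain ⟨r, rfl⟩ := hx
  obtain ⟨s, rfl⟩ := hy
  exact ⟨_, (hu.lie_smul_smul r s g h).symm⟩

theorem mem_gradingCentralizer (hgh : c g h = 0) : h ∈ gradingCentralizer Γ g := by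
  intro x hx y hy
  rw [hu.mem_component_iff] at hx hy
  obtain ⟨r, rfl⟩ := hx
  obtain ⟨s, rfl⟩ := hy
  rw [hu.lie_smul_smul, hgh, mul_zero, zero_smul]

theorem coeff_ne_zero_iff : c g h ≠ 0 ↔ sympForm g h ≠ 0 := (hu.coeff_eq_zero_iff g h).not

theorem add_ne_zero_of_coeff_ne_zero (hgh : c g h ≠ 0) : g + h ≠ 0 :=
  add_ne_zero_of_sympForm (hu.coeff_ne_zero_iff.mp hgh)

theorem coeff_swap (g h : k × k) : c h g = -c g h := by
  by_cases hgh : g + h = 0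
  · have coeff_eq_zero {g h : k × k} (hgh : g + h = 0) : c g h = 0 := by
      by_contra hc
      exact hu.add_ne_zero_of_coeff_ne_zero hc hgh
    rw [coeff_eq_zero hgh, coeff_eq_zero (add_comm g h ▸ hgh), neg_zero]
  · refine smul_left_injective K ((hu.eq_zero_iff _).not.mpr hgh) ?_
    change c h g • u (g + h) = -c g h • u (g + h)
    rw [neg_smul, ← hu.lie, lie_skew, hu.lie, add_comm]

theorem mem_gradedIdentities_iff {f : FreeGradedLie K (k × k)} :
    f ∈ gradedIdentities Γ ↔ ∀ t, scaledEval u t f = 0 := by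
  refine ⟨fun hf t => hf _ fun g i => hu.mem_component_iff.mpr ⟨_, rfl⟩, fun hf a ha => ?_⟩
  have exists_scalar (x : (k × k) × ℕ) : ∃ r : K, r • u x.1 = a x :=
    hu.mem_component_iff.mp (ha x.1 x.2)
  choose t ht using exists_scalar
  exact funext ht ▸ hf t

theorem mem_gradedIdentities_iff_of_scaledEval {f : FreeGradedLie K (k × k)}
    {m : ((k × k) × ℕ → K) → K} (hm : m 1 = 1) {r : K}
    (hf : ∀ t, scaledEval u t f = (m t * r) • u g) :
    f ∈ gradedIdentities Γ ↔ r = 0 ∨ g = 0 := by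
  simp only [hu.mem_gradedIdentities_iff, hf, smul_eq_zero, mul_eq_zero, hu.eq_zero_iff]
  refine ⟨fun hall => ?_, fun hr t => hr.imp_left .inr⟩
  simpa only [hm, one_ne_zero, false_or] using hall 1

theorem scaledEval_comm3 (t : (k × k) × ℕ → K) (i j n : ℕ) (g h l : k × k) :
    scaledEval u t (comm3 K i g j h n l) =
      (t (g, i) * t (h, j) * t (l, n) * (c g h * c (g + h) l)) • u (g + h + l) := by
  simp only [comm3, LieHom.map_lie, scaledEval_gvar, hu.lie_smul_smul]
  ring_nf

theorem scaledEval_comm4 (t : (k × k) × ℕ → K) (i j n m : ℕ) (g h l r : k × k) :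
    scaledEval u t (comm4 K i g j h n l m r) =
      (t (g, i) * t (h, j) * t (l, n) * t (r, m) * (c g h * c (g + h) l * c (g + h + l) r)) •
        u (g + h + l + r) := by
  simp only [comm4, LieHom.map_lie, scaledEval_gvar, hu.lie_smul_smul]
  ring_nf

theorem cubicAdmissible_iff : CubicAdmissible Γ g h l ↔ c g h * c (g + h) l ≠ 0 := by
  rw [CubicAdmissible, hu.mem_gradedIdentities_iff_of_scaledEval (by simp)
    (hu.scaledEval_comm3 · 1 2 3 g h l), not_or, and_iff_left_iff_imp]
  exact fun hc => hu.add_ne_zero_of_coeff_ne_zero (right_ne_zero_of_mul hc)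

theorem comm4_notMem_gradedIdentities_iff {i j n m : ℕ} :
    comm4 K i g₁ j g₂ n g₃ m g₄ ∉ gradedIdentities Γ ↔
      c g₁ g₂ * c (g₁ + g₂) g₃ * c (g₁ + g₂ + g₃) g₄ ≠ 0 := by
  rw [hu.mem_gradedIdentities_iff_of_scaledEval (by simp)
    (hu.scaledEval_comm4 · i j n m g₁ g₂ g₃ g₄), not_or, and_iff_left_iff_imp]
  exact fun hc => hu.add_ne_zero_of_coeff_ne_zero (right_ne_zero_of_mul hc)

theorem quarticAdmissible_iff :
    QuarticAdmissible Γ g₁ g₂ g₃ g₄ ↔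
      c g₄ g₁ * c (g₄ + g₁) g₂ * c (g₄ + g₁ + g₂) g₃ ≠ 0 ∧
        c g₄ g₃ * c (g₄ + g₃) g₂ * c (g₄ + g₃ + g₂) g₁ ≠ 0 := by
  rw [QuarticAdmissible, hu.comm4_notMem_gradedIdentities_iff,
    hu.comm4_notMem_gradedIdentities_iff]

theorem cubicPoly_mem_gradedIdentities_iff (hA : CubicAdmissible Γ g h l) (r : K) :
    cubicPoly r g h l ∈ gradedIdentities Γ ↔ r = cubicScalar c g h l := by
  rw [hu.cubicAdmissible_iff] at hA
  have hsum : g + h + l ≠ 0 := hu.add_ne_zero_of_coeff_ne_zero (right_ne_zero_of_mul hA)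
  have heval (t) : scaledEval u t (cubicPoly r g h l) = (t (g, 1) * t (h, 2) * t (l, 3) *
      (c g l * c (g + l) h - r * (c g h * c (g + h) l))) • u (g + h + l) := by
    rw [cubicPoly, map_sub, map_smul, hu.scaledEval_comm3, hu.scaledEval_comm3,
      add_right_comm g l h, smul_smul, ← sub_smul]
    ring_nf
  rw [hu.mem_gradedIdentities_iff_of_scaledEval (by simp) heval, or_iff_left hsum, sub_eq_zero,
    cubicScalar, eq_div_iff hA, eq_comm]

theorem quarticPoly_mem_gradedIdentities_iff (hA : QuarticAdmissible Γ g₁ g₂ g₃ g₄) (r : K) :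
    quarticPoly r g₁ g₂ g₃ g₄ ∈ gradedIdentities Γ ↔ r = quarticScalar c g₁ g₂ g₃ g₄ := by
  obtain ⟨hA', hA⟩ := hu.quarticAdmissible_iff.mp hA
  have hsum : g₄ + g₁ + g₂ + g₃ ≠ 0 := hu.add_ne_zero_of_coeff_ne_zero (right_ne_zero_of_mul hA')
  have hcomm : g₄ + g₃ + g₂ + g₁ = g₄ + g₁ + g₂ + g₃ := by abel
  have heval (t) : scaledEval u t (quarticPoly r g₁ g₂ g₃ g₄) =
      (t (g₁, 1) * t (g₂, 2) * t (g₃, 3) * t (g₄, 4) *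
      (c g₄ g₁ * c (g₄ + g₁) g₂ * c (g₄ + g₁ + g₂) g₃ -
        r * (c g₄ g₃ * c (g₄ + g₃) g₂ * c (g₄ + g₃ + g₂) g₁))) • u (g₄ + g₁ + g₂ + g₃) := by
    rw [quarticPoly, map_sub, map_smul, hu.scaledEval_comm4, hu.scaledEval_comm4, hcomm,
      smul_smul, ← sub_smul]
    ring_nf
  rw [hu.mem_gradedIdentities_iff_of_scaledEval (by simp) heval, or_iff_left hsum, sub_eq_zero,
    quarticScalar, eq_div_iff hA, eq_comm]

theorem quarticScalar_ne_zero (hA : QuarticAdmissible Γ g₁ g₂ g₃ g₄) :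
    quarticScalar c g₁ g₂ g₃ g₄ ≠ 0 :=
  div_ne_zero (hu.quarticAdmissible_iff.mp hA).1 (hu.quarticAdmissible_iff.mp hA).2

end IsPauliSystem

end PauliSystem

section GradedQuotient

variable {K : Type*} [Field K] {G : Type*} [AddCommGroup G] {I : LieIdeal K (FreeGradedLie K G)}
  {g h l g₁ g₂ g₃ g₄ : G} {x y z w : FreeGradedLie K G ⧸ I} {r : K}

theorem mk'_lie {L : Type*} [LieRing L] [LieAlgebra K L] {I : LieIdeal K L} (x y : L) :
    LieSubmodule.Quotient.mk' I ⁅x, y⁆ =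
      ⁅LieSubmodule.Quotient.mk' I x, LieSubmodule.Quotient.mk' I y⁆ := rfl

/-- The homogeneous component of degree `g` of the quotient of `L⟨X_G⟩` by `I`. -/
noncomputable def quotientComponent (I : LieIdeal K (FreeGradedLie K G)) (g : G) :
    Submodule K (FreeGradedLie K G ⧸ I) :=
  (freeComponent K g).map (LieSubmodule.Quotient.mk' I : FreeGradedLie K G →ₗ[K] _)

theorem lie_mem_quotientComponent (hx : x ∈ quotientComponent I g)
    (hy : y ∈ quotientComponent I h) : ⁅x, y⁆ ∈ quotientComponent I (g + h) := by
  obtain ⟨x, hx, rfl⟩ := hx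
  obtain ⟨y, hy, rfl⟩ := hy
  exact ⟨⁅x, y⁆, lie_mem_freeComponent hx hy, mk'_lie x y⟩

namespace IsTIdeal

theorem eq_zero_of_gvar_mem (hI : IsTIdeal I) (hf : gvar K 1 g ∈ I)
    (hx : x ∈ quotientComponent I g) : x = 0 := by
  obtain ⟨x, hx, rfl⟩ := hx
  exact (LieSubmodule.Quotient.mk_eq_zero _).mpr (hI.mem_of_gvar_mem hx hf)

theorem lie_eq_zero_of_lie_gvar_mem (hI : IsTIdeal I) (hf : ⁅gvar K 1 g, gvar K 2 h⁆ ∈ I)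
    (hx : x ∈ quotientComponent I g) (hy : y ∈ quotientComponent I h) : ⁅x, y⁆ = 0 := by
  obtain ⟨x, hx, rfl⟩ := hx
  obtain ⟨y, hy, rfl⟩ := hy
  exact (LieSubmodule.Quotient.mk_eq_zero _).mpr (hI.lie_mem_of_lie_gvar_mem hx hy hf)

theorem lie_lie_eq_of_cubicPoly_mem (hI : IsTIdeal I) (hf : cubicPoly r g h l ∈ I)
    (hx : x ∈ quotientComponent I g) (hy : y ∈ quotientComponent I h)
    (hz : z ∈ quotientComponent I l) : ⁅⁅x, z⁆, y⁆ = r • ⁅⁅x, y⁆, z⁆ := by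
  obtain ⟨x, hx, rfl⟩ := hx
  obtain ⟨y, hy, rfl⟩ := hy
  obtain ⟨z, hz, rfl⟩ := hz
  rw [← sub_eq_zero]
  exact (LieSubmodule.Quotient.mk_eq_zero _).mpr (hI.cubic_mem hx hy hz hf)

theorem lie_lie_lie_eq_of_quarticPoly_mem (hI : IsTIdeal I)
    (hf : quarticPoly r g₁ g₂ g₃ g₄ ∈ I) (hx : x ∈ quotientComponent I g₁)
    (hy : y ∈ quotientComponent I g₂) (hz : z ∈ quotientComponent I g₃)
    (hw : w ∈ quotientComponent I g₄) : ⁅⁅⁅w, x⁆, y⁆, z⁆ = r • ⁅⁅⁅w, z⁆, y⁆, x⁆ := by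
  obtain ⟨x, hx, rfl⟩ := hx
  obtain ⟨y, hy, rfl⟩ := hy
  obtain ⟨z, hz, rfl⟩ := hz
  obtain ⟨w, hw, rfl⟩ := hw
  rw [← sub_eq_zero]
  exact (LieSubmodule.Quotient.mk_eq_zero _).mpr (hI.quartic_mem hx hy hz hw hf)

end IsTIdeal

/-- A homogeneous element of the quotient of `L⟨X_G⟩` by `I`, together with its degree. The
parameter `c` only enters the multiplication of homogeneous elements, `x y = c(g, h)⁻¹ [x, y]` for
`x`, `y` of degrees `g`, `h`, where the product is `0` if `c(g, h) = 0`. -/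
@[ext]
structure Homogeneous (c : G → G → K) (I : LieIdeal K (FreeGradedLie K G)) where
  /-- The degree. -/
  deg : G
  /-- The element. -/
  val : FreeGradedLie K G ⧸ I
  val_mem : val ∈ quotientComponent I deg

namespace Homogeneous

variable {c : G → G → K}

noncomputable instance : Mul (Homogeneous c I) where
  mul v w := ⟨v.deg + w.deg, (c v.deg w.deg)⁻¹ • ⁅v.val, w.val⁆,
    Submodule.smul_mem _ _ (lie_mem_quotientComponent v.val_mem w.val_mem)⟩

theorem deg_mul (v w : Homogeneous c I) : (v * w).deg = v.deg + w.deg := rfl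

theorem val_mul (v w : Homogeneous c I) :
    (v * w).val = (c v.deg w.deg)⁻¹ • ⁅v.val, w.val⁆ := rfl

/-- The class of the variable `x_i^g`. -/
noncomputable def var (c : G → G → K) (I : LieIdeal K (FreeGradedLie K G)) (x : G × ℕ) :
    Homogeneous c I where
  deg := x.1
  val := LieSubmodule.Quotient.mk' I (gvar K x.2 x.1)
  val_mem := ⟨_, gvar_mem_freeComponent x.2 x.1, rfl⟩

theorem deg_comp_var : deg ∘ var c I = Prod.fst := rfl

end Homogeneous

end GradedQuotient

section IdentityBasis

variable {K : Type*} [Field K] {k : Type*} [CommRing k] {L : Type*} [LieRing L] [LieAlgebra K L]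

/-- The proposed basis of the graded identities of a Pauli system with structure constants `c`. -/
def identityBasis (Γ : k × k → Submodule K L) (c : k × k → k × k → K) :
    Set (FreeGradedLie K (k × k)) :=
  basisOne Γ ∪ basisTwo Γ ∪ basisThree Γ (cubicScalar c) ∪ basisFour Γ (quarticScalar c)

namespace IsPauliSystem

variable {Γ : k × k → Submodule K L} {u : k × k → L} {c : k × k → k × k → K}
  {I : LieIdeal K (FreeGradedLie K (k × k))} {g h : k × k} {x y : FreeGradedLie K (k × k) ⧸ I}
  (hu : IsPauliSystem Γ u c)
include hu

theorem identityBasis_subset_gradedIdentities : identityBasis Γ c ⊆ gradedIdentities Γ := by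
  rintro f (((⟨g, hg, rfl⟩ | ⟨g, h, hgh, -, rfl⟩) | ⟨g, h, l, hA, rfl⟩) |
    ⟨g₁, g₂, g₃, g₄, hA, rfl⟩)
  · intro a ha
    rw [gvar, FreeLieAlgebra.lift_of_apply]
    simpa only [not_not.mp hg, Submodule.mem_bot] using ha g 1
  · intro a ha
    simp only [LieHom.map_lie, gvar, FreeLieAlgebra.lift_of_apply]
    exact hgh _ (ha g 1) _ (ha h 2)
  · exact (hu.cubicPoly_mem_gradedIdentities_iff hA _).mpr rfl
  · exact (hu.quarticPoly_mem_gradedIdentities_iff hA _).mpr rfl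

theorem tIdealSpan_identityBasis_subset_gradedIdentities :
    (tIdealSpan (identityBasis Γ c) : Set (FreeGradedLie K (k × k))) ⊆ gradedIdentities Γ :=
  tIdealSpan_le (I := gradedIdentityIdeal Γ) (isTIdeal_gradedIdentityIdeal hu.lie_mem)
    hu.identityBasis_subset_gradedIdentities

variable (hI : IsTIdeal I) (hS : identityBasis Γ c ⊆ (I : Set (FreeGradedLie K (k × k))))
include hI hS

theorem eq_zero_of_mem_quotientComponent_zero (hx : x ∈ quotientComponent I 0) : x = 0 :=
  hI.eq_zero_of_gvar_mem
    (hS (.inl (.inl (.inl ⟨0, hu.mem_gradingSupport_iff.not.mpr (not_not.mpr rfl), rfl⟩)))) hx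

theorem lie_eq_zero_of_coeff_eq_zero (hgh : c g h = 0) (hx : x ∈ quotientComponent I g)
    (hy : y ∈ quotientComponent I h) : ⁅x, y⁆ = 0 := by
  by_cases hsum : g + h = 0
  · exact hu.eq_zero_of_mem_quotientComponent_zero hI hS (hsum ▸ lie_mem_quotientComponent hx hy)
  · exact hI.lie_eq_zero_of_lie_gvar_mem (hS (.inl (.inl (.inr
      ⟨g, h, hu.mem_gradingCentralizer hgh, hu.mem_gradingSupport_iff.mpr hsum, rfl⟩)))) hx hy

theorem isSympMagma_homogeneous :
    IsSympMagma (Homogeneous.deg : Homogeneous c I → k × k) where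
  mul_comm v w := by
    refine Homogeneous.ext (add_comm _ _) ?_
    rw [Homogeneous.val_mul, Homogeneous.val_mul, hu.coeff_swap v.deg w.deg, ← lie_skew, inv_neg,
      neg_smul, smul_neg]
  deg_mul := Homogeneous.deg_mul
  cubic x y z hxy hxyz hxz hxzy := by
    rw [← hu.coeff_ne_zero_iff] at hxy hxyz hxz hxzy
    have hrel : ⁅⁅x.val, z.val⁆, y.val⁆ =
        cubicScalar c x.deg y.deg z.deg • ⁅⁅x.val, y.val⁆, z.val⁆ :=
      hI.lie_lie_eq_of_cubicPoly_mem (hS (.inl (.inr ⟨_, _, _,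
        hu.cubicAdmissible_iff.mpr (mul_ne_zero hxy hxyz), rfl⟩))) x.val_mem y.val_mem z.val_mem
    refine Homogeneous.ext (add_right_comm _ _ _) ?_
    simp only [Homogeneous.val_mul, Homogeneous.deg_mul, smul_lie, smul_smul, hrel]
    congr 1
    rw [cubicScalar]
    field_simp
  quartic w x y z hwx hwxy hwxyz hwz hwzy hwzyx := by
    rw [← hu.coeff_ne_zero_iff] at hwx hwxy hwxyz hwz hwzy hwzyx
    have hA : QuarticAdmissible Γ x.deg y.deg z.deg w.deg := hu.quarticAdmissible_iff.mpr
      ⟨mul_ne_zero (mul_ne_zero hwx hwxy) hwxyz, mul_ne_zero (mul_ne_zero hwz hwzy) hwzyx⟩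
    have hrel : ⁅⁅⁅w.val, x.val⁆, y.val⁆, z.val⁆ =
        quarticScalar c x.deg y.deg z.deg w.deg • ⁅⁅⁅w.val, z.val⁆, y.val⁆, x.val⁆ :=
      hI.lie_lie_lie_eq_of_quarticPoly_mem (hS (.inr ⟨_, _, _, _, hA, rfl⟩))
        x.val_mem y.val_mem z.val_mem w.val_mem
    have hdeg : w.deg + x.deg + y.deg + z.deg = w.deg + z.deg + y.deg + x.deg := by abel
    refine Homogeneous.ext hdeg ?_
    simp only [Homogeneous.val_mul, Homogeneous.deg_mul, smul_lie, smul_smul, hrel]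
    congr 1
    rw [quarticScalar]
    field_simp

end IsPauliSystem

end IdentityBasis

section MonomialFunctions

theorem linearIndependent_multiset_prod_map {K : Type*} [CommRing K] [IsDomain K] [Infinite K]
    {σ : Type*} : LinearIndependent K fun (μ : Multiset σ) (t : σ → K) => (μ.map t).prod := by
  classical
  let evalFun : MvPolynomial σ K →ₗ[K] (σ → K) → K :=
    LinearMap.pi fun t => (MvPolynomial.aeval t).toLinearMap
  have hker : LinearMap.ker evalFun = ⊥ := by
    refine LinearMap.ker_eq_bot'.mpr fun p hp => MvPolynomial.funext fun t => ?_
    rw [map_zero]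
    exact congrFun hp t
  have hmonomial : (fun (μ : Multiset σ) (t : σ → K) => (μ.map t).prod) =
      (evalFun ∘ MvPolynomial.basisMonomials σ K) ∘ Multiset.toFinsupp := by
    ext μ t
    simp [evalFun, MvPolynomial.aeval_monomial, Finsupp.prod, Finset.prod_multiset_map_count]
  rw [hmonomial]
  exact ((MvPolynomial.basisMonomials σ K).linearIndependent.map' evalFun hker).comp _
    Multiset.toFinsupp.injective

theorem smul_eq_zero_of_forall_linearCombination_eq_zero {K : Type*} [Field K] [Infinite K]
    {V σ : Type*} [AddCommGroup V] [Module K V] {w : Multiset σ → V} {P : Multiset σ →₀ K}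
    (hP : ∀ t : σ → K, Finsupp.linearCombination K (fun μ => (μ.map t).prod • w μ) P = 0)
    (μ : Multiset σ) : P μ • w μ = 0 := by
  by_cases hμ : μ ∈ P.support
  · refine (Module.forall_dual_apply_eq_zero_iff K _).mp fun φ => ?_
    rw [map_smul, smul_eq_mul]
    have hli : LinearIndependent K fun (μ : Multiset σ) (t : σ → K) => (μ.map t).prod :=
      linearIndependent_multiset_prod_map
    refine linearIndependent_iff'.mp hli P.support (fun μ => P μ * φ (w μ))
      (funext fun t => ?_) μ hμ
    simp only [Finset.sum_apply, Pi.smul_apply, Pi.zero_apply, smul_eq_mul]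
    simpa only [Finsupp.linearCombination_apply, Finsupp.sum, map_sum, map_smul, map_zero,
      smul_eq_mul, mul_assoc, mul_comm (φ _)] using congrArg φ (hP t)
  · rw [Finsupp.notMem_support_iff.mp hμ, zero_smul]

end MonomialFunctions

section Completeness

variable {K : Type*} [Field K] {k : Type*} [CommRing k]

open Classical in
/-- The common value in the quotient by `I` of all products of the variables `μ` in which only
elements whose degrees pair nontrivially are multiplied, or `0` if there is no such product. -/
noncomputable def normalForm (c : k × k → k × k → K) (I : LieIdeal K (FreeGradedLie K (k × k)))
    (μ : Multiset ((k × k) × ℕ)) : FreeGradedLie K (k × k) ⧸ I :=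
  if h : (mergeResults Homogeneous.deg (μ.map (Homogeneous.var c I))).Nonempty then h.some.val
  else 0

namespace IsPauliSystem

variable {L : Type*} [LieRing L] [LieAlgebra K L] {Γ : k × k → Submodule K L} {u : k × k → L}
  {c : k × k → k × k → K} {I : LieIdeal K (FreeGradedLie K (k × k))}
  (hu : IsPauliSystem Γ u c) (hI : IsTIdeal I)
  (hS : identityBasis Γ c ⊆ (I : Set (FreeGradedLie K (k × k))))
  {μ : Multiset ((k × k) × ℕ)} {v : Homogeneous c I} {f : FreeGradedLie K (k × k)} {g : k × k}
include hu hI hS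

theorem deg_eq_of_mergesTo (hv : MergesTo Homogeneous.deg (μ.map (Homogeneous.var c I)) v) :
    v.deg = (μ.map Prod.fst).sum := by
  rw [hv.deg_eq (hu.isSympMagma_homogeneous hI hS), Multiset.map_map, Homogeneous.deg_comp_var]

theorem exists_mergesTo_of_isGradedMonomial (hf : IsGradedMonomial f g) :
    (LieSubmodule.Quotient.mk' I f = 0 ∧ ∀ t, scaledEval u t f = 0) ∨
      ∃ (μ : Multiset ((k × k) × ℕ)) (r : K) (v : Homogeneous c I),
        MergesTo Homogeneous.deg (μ.map (Homogeneous.var c I)) v ∧ v.deg = g ∧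
        LieSubmodule.Quotient.mk' I f = r • v.val ∧
        ∀ t, scaledEval u t f = (r * (μ.map t).prod) • u g := by
  induction hf with
  | var i g =>
    refine .inr ⟨{(g, i)}, 1, .var c I (g, i), ?_, rfl, (one_smul K _).symm, fun t => ?_⟩
    · exact .single _
    · rw [scaledEval_gvar, Multiset.map_singleton, Multiset.prod_singleton, one_mul]
  | @bracket a b g h ha hb iha ihb =>
    simp only [mk'_lie, LieHom.map_lie]
    obtain ⟨ha₀, hat⟩ | ⟨μ, r, v, hμ, rfl, har, hat⟩ := iha
    · exact .inl ⟨by rw [ha₀, zero_lie], fun t => by rw [hat, zero_lie]⟩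
    obtain ⟨hb₀, hbt⟩ | ⟨ν, s, w, hν, rfl, hbs, hbt⟩ := ihb
    · exact .inl ⟨by rw [hb₀, lie_zero], fun t => by rw [hbt, lie_zero]⟩
    by_cases hc : c v.deg w.deg = 0
    · refine .inl ⟨?_, fun t => ?_⟩
      · rw [har, hbs, smul_lie, lie_smul,
          hu.lie_eq_zero_of_coeff_eq_zero hI hS hc v.val_mem w.val_mem, smul_zero, smul_zero]
      · rw [hat, hbt, hu.lie_smul_smul, hc, mul_zero, zero_smul]
    · refine .inr ⟨μ + ν, r * s * c v.deg w.deg, v * w, ?_, rfl, ?_, fun t => ?_⟩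
      · rw [Multiset.map_add]
        exact hμ.mul hν (hu.coeff_ne_zero_iff.mp hc)
      · rw [har, hbs, smul_lie, lie_smul, Homogeneous.val_mul, smul_smul, smul_smul,
          mul_inv_cancel_right₀ hc]
      · rw [hat, hbt, hu.lie_smul_smul, Multiset.map_add, Multiset.prod_add]
        ring_nf

variable [NoZeroDivisors k]

theorem normalForm_eq (hv : MergesTo Homogeneous.deg (μ.map (Homogeneous.var c I)) v) :
    normalForm c I μ = v.val := by
  have hne : (mergeResults Homogeneous.deg (μ.map (Homogeneous.var c I))).Nonempty := ⟨v, hv⟩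
  rw [normalForm, dif_pos hne]
  exact congrArg _ (mergeResults_subsingleton (hu.isSympMagma_homogeneous hI hS) _ hne.some_mem hv)

theorem normalForm_eq_zero (hμ : (μ.map Prod.fst).sum = 0) : normalForm c I μ = 0 := by
  by_cases hne : (mergeResults Homogeneous.deg (μ.map (Homogeneous.var c I))).Nonempty
  · obtain ⟨v, hv⟩ := hne
    rw [hu.normalForm_eq hI hS hv]
    refine hu.eq_zero_of_mem_quotientComponent_zero hI hS ?_
    rw [← hμ, ← hu.deg_eq_of_mergesTo hI hS hv]
    exact v.val_mem
  · exact dif_neg hne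

theorem exists_linearCombination_normalForm (f : FreeGradedLie K (k × k)) :
    ∃ P : Multiset ((k × k) × ℕ) →₀ K,
      LieSubmodule.Quotient.mk' I f = Finsupp.linearCombination K (normalForm c I) P ∧
      ∀ t, scaledEval u t f = Finsupp.linearCombination K
        (fun μ => (μ.map t).prod • u (μ.map Prod.fst).sum) P := by
  have hf : f ∈ Submodule.span K {f : FreeGradedLie K (k × k) | ∃ g, IsGradedMonomial f g} :=
    span_isGradedMonomial (K := K) (G := k × k) ▸ Submodule.mem_top
  induction hf using Submodule.span_induction with
  | mem f hf =>
    obtain ⟨g, hg⟩ := hf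
    obtain ⟨hf₀, hft⟩ | ⟨μ, r, v, hμ, rfl, hfr, hft⟩ :=
      hu.exists_mergesTo_of_isGradedMonomial hI hS hg
    · exact ⟨0, by rw [hf₀, map_zero], fun t => by rw [hft, map_zero]⟩
    · refine ⟨.single μ r, ?_, fun t => ?_⟩
      · rw [Finsupp.linearCombination_single, hfr, hu.normalForm_eq hI hS hμ]
      · rw [Finsupp.linearCombination_single, hft, hu.deg_eq_of_mergesTo hI hS hμ, smul_smul]
  | zero => exact ⟨0, by simp only [map_zero], fun t => by simp only [map_zero]⟩
  | add f f' _ _ hf hf' =>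
    obtain ⟨P, hP, hPt⟩ := hf
    obtain ⟨Q, hQ, hQt⟩ := hf'
    exact ⟨P + Q, by rw [map_add, map_add, hP, hQ], fun t => by rw [map_add, map_add, hPt, hQt]⟩
  | smul r f _ hf =>
    obtain ⟨P, hP, hPt⟩ := hf
    exact ⟨r • P, by rw [map_smul, map_smul, hP], fun t => by rw [map_smul, map_smul, hPt]⟩

theorem gradedIdentities_subset [Infinite K] :
    gradedIdentities Γ ⊆ (I : Set (FreeGradedLie K (k × k))) := by
  intro f hf
  obtain ⟨P, hP, hPt⟩ := hu.exists_linearCombination_normalForm hI hS f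
  have hcoeff (μ) : P μ • u (μ.map Prod.fst).sum = 0 :=
    smul_eq_zero_of_forall_linearCombination_eq_zero
      (fun t => (hPt t).symm.trans (hu.mem_gradedIdentities_iff.mp hf t)) μ
  refine (LieSubmodule.Quotient.mk_eq_zero _).mp (hP.trans (Finset.sum_eq_zero fun μ _ => ?_))
  obtain hμ | hμ := smul_eq_zero.mp (hcoeff μ)
  · exact smul_eq_zero_of_left hμ _
  · exact smul_eq_zero_of_right _
      (hu.normalForm_eq_zero hI hS ((hu.eq_zero_iff _).mp hμ))

omit hI hS in
theorem tIdealSpan_identityBasis [Infinite K] :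
    (tIdealSpan (identityBasis Γ c) : Set (FreeGradedLie K (k × k))) = gradedIdentities Γ := by
  refine hu.tIdealSpan_identityBasis_subset_gradedIdentities.antisymm fun f hf => ?_
  rw [tIdealSpan, LieSubmodule.coe_sInf, Set.mem_iInter₂]
  exact fun I hI => hu.gradedIdentities_subset hI.1 hI.2 hf

end IsPauliSystem

end Completeness

section PauliMatrices

variable {K : Type*} [Field K] {q : ℕ} {ε : K}

theorem pauliA_pow_eq_one (hε : ε ^ q = 1) : pauliA q ε ^ q = 1 := by
  rw [pauliA, Matrix.diagonal_pow, ← Matrix.diagonal_one]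
  congr 1
  funext i
  rw [Pi.pow_apply, pow_right_comm, hε, one_pow]

theorem pauliB_pow_apply [NeZero q] (n : ℕ) (i j : Fin q) :
    (pauliB q ^ n : Matrix (Fin q) (Fin q) K) i j = if (j : ℕ) = (i + n) % q then 1 else 0 := by
  induction n generalizing j with
  | zero =>
    rw [pow_zero, Matrix.one_apply, add_zero, Nat.mod_eq_of_lt i.2]
    simp only [Fin.ext_iff, eq_comm]
  | succ n ih =>
    have hlt : ((i : ℕ) + n) % q < q := Nat.mod_lt _ (Nat.pos_of_neZero q)
    rw [pow_succ, Matrix.mul_apply, Finset.sum_eq_single (⟨((i : ℕ) + n) % q, hlt⟩ : Fin q)]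
    · rw [ih, if_pos rfl, one_mul]
      simp [pauliB, add_assoc]
    · intro b _ hb
      rw [ih, if_neg fun h => hb (Fin.ext h), zero_mul]
    · exact fun hnotMem => absurd (Finset.mem_univ _) hnotMem

theorem pauliB_pow_eq_one [NeZero q] : (pauliB q ^ q : Matrix (Fin q) (Fin q) K) = 1 := by
  ext i j
  rw [pauliB_pow_apply, Matrix.one_apply, Nat.add_mod_right, Nat.mod_eq_of_lt i.2]
  simp only [Fin.ext_iff, eq_comm]

theorem pauliA_mul_pauliB (hε : ε ^ q = 1) :
    pauliA q ε * pauliB q = ε • (pauliB q * pauliA q ε) := by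
  ext i j
  rw [Matrix.smul_apply, pauliA, Matrix.diagonal_mul, Matrix.mul_diagonal, pauliB, Matrix.of_apply]
  split_ifs with hj
  · rw [mul_one, one_mul, smul_eq_mul, ← pow_succ', hj]
    obtain hi | hi : (i : ℕ) + 1 < q ∨ (i : ℕ) + 1 = q := by omega
    · rw [Nat.mod_eq_of_lt hi]
      congr 1
      omega
    · rw [hi, Nat.mod_self, Nat.sub_zero, Nat.sub_add_cancel (hi ▸ Nat.le_add_left 1 _), hε,
        show q - 1 - (i : ℕ) = 0 by omega, pow_zero]
  · rw [mul_zero, zero_mul, smul_zero]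

theorem pauliB_pow_mul_pauliA_pow [NeZero q] (hε : ε ^ q = 1) (m n : ℕ) :
    pauliB q ^ m * pauliA q ε ^ n = ε⁻¹ ^ (m * n) • (pauliA q ε ^ n * pauliB q ^ m) := by
  have hε₀ : ε ≠ 0 := (IsUnit.of_pow_eq_one hε (NeZero.ne q)).ne_zero
  have hAB : SemiconjBy (pauliA q ε) (pauliB q ^ m) (ε ^ m • pauliB q ^ m) := by
    rw [← smul_pow]
    refine SemiconjBy.pow_right ?_ m
    rw [SemiconjBy, pauliA_mul_pauliB hε, smul_mul_assoc]
  have hBA : SemiconjBy (pauliB q ^ m) (pauliA q ε) (ε⁻¹ ^ m • pauliA q ε) := by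
    rw [SemiconjBy, smul_mul_assoc, hAB.eq, smul_mul_assoc, smul_smul, ← mul_pow,
      inv_mul_cancel₀ hε₀, one_pow, one_smul]
  rw [(hBA.pow_right n).eq, smul_pow, ← pow_mul, smul_mul_assoc]

variable (ε) in
/-- The matrix `A^i B^j`, where `g = (i, j)`. -/
noncomputable def pauliMatrix (g : ZMod q × ZMod q) : Matrix (Fin q) (Fin q) K :=
  pauliA q ε ^ g.1.val * pauliB q ^ g.2.val

variable (ε) in
/-- The character `a ↦ ε^{-a}` of `ℤ_q`, by which the Pauli matrices commute. -/
noncomputable def pauliCharacter (a : ZMod q) : K := ε⁻¹ ^ a.val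

variable (ε) in
/-- The structure constants of the Pauli matrices:
`[A^i B^j, A^r B^s] = c((i, j), (r, s)) A^{i + r} B^{j + s}`. -/
noncomputable def pauliCoeff (g h : ZMod q × ZMod q) : K :=
  pauliCharacter ε (g.2 * h.1) - pauliCharacter ε (h.2 * g.1)

variable [NeZero q]

theorem pauliMatrix_ne_zero (hε : ε ^ q = 1) (g : ZMod q × ZMod q) : pauliMatrix ε g ≠ 0 :=
  (((IsUnit.of_pow_eq_one (pauliA_pow_eq_one hε) (NeZero.ne q)).pow _).mul
    ((IsUnit.of_pow_eq_one pauliB_pow_eq_one (NeZero.ne q)).pow _)).ne_zero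

theorem pauliMatrix_mul (hε : ε ^ q = 1) (g h : ZMod q × ZMod q) :
    pauliMatrix ε g * pauliMatrix ε h =
      pauliCharacter ε (g.2 * h.1) • pauliMatrix ε (g + h) := by
  rw [pauliMatrix, pauliMatrix, pauliMatrix, pauliCharacter, Prod.fst_add, Prod.snd_add,
    ZMod.val_add, ZMod.val_add, ZMod.val_mul, ← pow_eq_pow_mod _ (pauliA_pow_eq_one hε),
    ← pow_eq_pow_mod _ pauliB_pow_eq_one, ← pow_eq_pow_mod _ (by rw [inv_pow, hε, inv_one]),
    mul_assoc, ← mul_assoc (pauliB q ^ _), pauliB_pow_mul_pauliA_pow hε, smul_mul_assoc,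
    mul_smul_comm, pow_add, pow_add]
  simp only [mul_assoc]

theorem pauliMatrix_lie (hε : ε ^ q = 1) (g h : ZMod q × ZMod q) :
    ⁅pauliMatrix ε g, pauliMatrix ε h⁆ = pauliCoeff ε g h • pauliMatrix ε (g + h) := by
  rw [Ring.lie_def, pauliMatrix_mul hε, pauliMatrix_mul hε, add_comm h g, pauliCoeff, sub_smul]

theorem pauliCharacter_injective (hε : IsPrimitiveRoot ε q) :
    Function.Injective (pauliCharacter ε : ZMod q → K) := fun a b hab =>
  ZMod.val_injective q (hε.inv.pow_inj (ZMod.val_lt a) (ZMod.val_lt b) hab)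

theorem pauliCoeff_eq_zero_iff (hε : IsPrimitiveRoot ε q) (g h : ZMod q × ZMod q) :
    pauliCoeff ε g h = 0 ↔ sympForm g h = 0 := by
  rw [pauliCoeff, sub_eq_zero, (pauliCharacter_injective hε).eq_iff, sympForm, sub_eq_zero,
    mul_comm h.2, eq_comm]

theorem trace_pauliMatrix (hε : IsPrimitiveRoot ε q) {g : ZMod q × ZMod q} (hg : g ≠ 0) :
    (pauliMatrix ε g).trace = 0 := by
  obtain ⟨h, hgh⟩ := exists_sympForm_ne_zero hg
  have hcoeff : pauliCoeff ε (g - h) h ≠ 0 := by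
    rw [Ne, pauliCoeff_eq_zero_iff hε]
    rwa [← sub_add_cancel g h, sympForm_add_left, sympForm_self, add_zero] at hgh
  have htrace : Matrix.trace ⁅pauliMatrix ε (g - h), pauliMatrix ε h⁆ = 0 := by
    rw [Ring.lie_def, Matrix.trace_sub, Matrix.trace_mul_comm, sub_self]
  rw [pauliMatrix_lie hε.pow_eq_one, sub_add_cancel, Matrix.trace_smul] at htrace
  exact (smul_eq_zero.mp htrace).resolve_left hcoeff

/-- The element `A^i B^j` of `sl_q(K)` if `g = (i, j) ≠ (0, 0)`, and zero otherwise. -/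
noncomputable def pauliElement (hε : IsPrimitiveRoot ε q) (g : ZMod q × ZMod q) :
    LieAlgebra.SpecialLinear.sl (Fin q) K :=
  if hg : g = 0 then 0 else ⟨pauliMatrix ε g, trace_pauliMatrix hε hg⟩

theorem pauliElement_zero (hε : IsPrimitiveRoot ε q) : pauliElement hε 0 = 0 := dif_pos rfl

theorem coe_pauliElement (hε : IsPrimitiveRoot ε q) {g : ZMod q × ZMod q} (hg : g ≠ 0) :
    (pauliElement hε g : Matrix (Fin q) (Fin q) K) = pauliMatrix ε g := by
  rw [pauliElement, dif_neg hg]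

theorem pauliElement_eq_zero_iff (hε : IsPrimitiveRoot ε q) (g : ZMod q × ZMod q) :
    pauliElement hε g = 0 ↔ g = 0 := by
  refine ⟨fun hzero => ?_, fun hg => hg ▸ pauliElement_zero hε⟩
  by_contra hg
  exact pauliMatrix_ne_zero hε.pow_eq_one g (by rw [← coe_pauliElement hε hg, hzero]; rfl)

theorem pauliComponent_eq_span (hε : IsPrimitiveRoot ε q) (g : ZMod q × ZMod q) :
    pauliComponent q ε g = Submodule.span K {pauliElement hε g} := by
  by_cases hg : g = 0
  · rw [hg, pauliElement_zero, pauliComponent, if_pos rfl, Submodule.span_zero_singleton]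
  · ext x
    rw [pauliComponent, if_neg hg, Submodule.mem_comap, Submodule.mem_span_singleton,
      Submodule.mem_span_singleton]
    refine exists_congr fun r => ?_
    rw [Subtype.ext_iff]
    exact (congrArg (r • · = (x : Matrix (Fin q) (Fin q) K)) (coe_pauliElement hε hg)).symm.to_iff

theorem pauliElement_lie (hε : IsPrimitiveRoot ε q) (g h : ZMod q × ZMod q) :
    ⁅pauliElement hε g, pauliElement hε h⁆ = pauliCoeff ε g h • pauliElement hε (g + h) := by
  by_cases hg : g = 0
  · have hcoeff : pauliCoeff ε g h = 0 := by
      rw [pauliCoeff_eq_zero_iff hε, hg, sympForm_zero_left]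
    rw [hcoeff, hg, pauliElement_zero, zero_lie, zero_smul]
  by_cases hh : h = 0
  · have hcoeff : pauliCoeff ε g h = 0 := by
      rw [pauliCoeff_eq_zero_iff hε, hh, sympForm_zero_right]
    rw [hcoeff, hh, pauliElement_zero, lie_zero, zero_smul]
  apply Subtype.ext
  change ⁅(pauliElement hε g : Matrix (Fin q) (Fin q) K),
    (pauliElement hε h : Matrix (Fin q) (Fin q) K)⁆ =
      pauliCoeff ε g h • (pauliElement hε (g + h) : Matrix (Fin q) (Fin q) K)
  rw [coe_pauliElement hε hg, coe_pauliElement hε hh, pauliMatrix_lie hε.pow_eq_one]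
  by_cases hcoeff : pauliCoeff ε g h = 0
  · rw [hcoeff, zero_smul, zero_smul]
  · rw [pauliCoeff_eq_zero_iff hε] at hcoeff
    rw [coe_pauliElement hε (add_ne_zero_of_sympForm hcoeff)]

theorem isPauliSystem_pauliElement (hε : IsPrimitiveRoot ε q) :
    IsPauliSystem (pauliComponent q ε) (pauliElement hε) (pauliCoeff ε) where
  span := pauliComponent_eq_span hε
  eq_zero_iff := pauliElement_eq_zero_iff hε
  lie := pauliElement_lie hε
  coeff_eq_zero_iff := pauliCoeff_eq_zero_iff hε

end PauliMatrices

theorem mainTheorem7_general {K : Type*} [Field K] [Infinite K] {k : Type*} [CommRing k]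
    [NoZeroDivisors k] {L : Type*} [LieRing L] [LieAlgebra K L] {Γ : k × k → Submodule K L}
    {u : k × k → L} {c : k × k → k × k → K} (hu : IsPauliSystem Γ u c) :
    ∃ (lam₃ : k × k → k × k → k × k → K) (lam₄ : k × k → k × k → k × k → k × k → K),
      (∀ g h l, CubicAdmissible Γ g h l →
        ∀ r : K, cubicPoly r g h l ∈ gradedIdentities Γ ↔ r = lam₃ g h l) ∧
      (∀ g₁ g₂ g₃ g₄, QuarticAdmissible Γ g₁ g₂ g₃ g₄ →
        lam₄ g₁ g₂ g₃ g₄ ≠ 0 ∧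
        ∀ r : K, quarticPoly r g₁ g₂ g₃ g₄ ∈ gradedIdentities Γ ↔ r = lam₄ g₁ g₂ g₃ g₄) ∧
      (tIdealSpan (basisOne Γ ∪ basisTwo Γ ∪ basisThree Γ lam₃ ∪ basisFour Γ lam₄) :
        Set (FreeGradedLie K (k × k))) = gradedIdentities Γ :=
  ⟨cubicScalar c, quarticScalar c,
    fun _ _ _ hA r => hu.cubicPoly_mem_gradedIdentities_iff hA r,
    fun _ _ _ _ hA => ⟨hu.quarticScalar_ne_zero hA,
      fun r => hu.quarticPoly_mem_gradedIdentities_iff hA r⟩,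
    hu.tIdealSpan_identityBasis⟩

theorem mainTheorem7 {K : Type*} [Field K] [Infinite K] (hK : ringChar K ≠ 2)
    (q : ℕ) (hq : q.Prime) (ε : K) (hε : IsPrimitiveRoot ε q) :
    ∃ (lam₃ : ZMod q × ZMod q → ZMod q × ZMod q → ZMod q × ZMod q → K)
      (lam₄ : ZMod q × ZMod q → ZMod q × ZMod q → ZMod q × ZMod q → ZMod q × ZMod q → K),
      (∀ g h k, CubicAdmissible (pauliComponent q ε) g h k →
        ∀ c : K, cubicPoly c g h k ∈ gradedIdentities (pauliComponent q ε) ↔ c = lam₃ g h k) ∧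
      (∀ g₁ g₂ g₃ g₄, QuarticAdmissible (pauliComponent q ε) g₁ g₂ g₃ g₄ →
        lam₄ g₁ g₂ g₃ g₄ ≠ 0 ∧
        ∀ c : K, quarticPoly c g₁ g₂ g₃ g₄ ∈ gradedIdentities (pauliComponent q ε) ↔
          c = lam₄ g₁ g₂ g₃ g₄) ∧
      (tIdealSpan (basisOne (pauliComponent q ε) ∪ basisTwo (pauliComponent q ε) ∪
          basisThree (pauliComponent q ε) lam₃ ∪ basisFour (pauliComponent q ε) lam₄) :
            Set (FreeGradedLie K (ZMod q × ZMod q))) =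
        gradedIdentities (pauliComponent q ε) := by
  have := Fact.mk hq
  exact mainTheorem7_general (isPauliSystem_pauliElement hε)
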